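/- Let $p=3$, let $m\ge 6$ be an even integer, $q=3^m$, and let $\pi$ be a primitive element of $\mathbb F_q$. Let $\mathcal C$ be the ternary cyclic code of length $l=q-1$ with nonzeros $\pi^{-2},\pi^{-(p+1)},\pi^{-(p^2+1)}$, i.e. the set of all $c\in\mathbb F_3^{l}$ such that $\sum_{i=0}^{l-1}c_i z^i=0$ for every $z\in\mathbb F_q^*$ that is not conjugate over $\mathbb F_3$ to one of these three elements. Let $A_w$ be the number of codewords of $\mathcal C$ of Hamming weight $w$. For $\alpha,\beta,\gamma\in\mathbb F_q$ put $$S(\alpha,\beta,\gamma)=\sum_{x\in\mathbb F_q}e^{\frac{2\pi i}{3}\mathrm{Tr}(\alpha x^2+\beta x^{p+1}+\gamma x^{p^2+1})},$$ where $\mathrm{Tr}:\mathbb F_q\to\mathbb F_3$ is the trace. For $\varepsilon=\pm1$ let $n_{\varepsilon,j}$ be the number of $(\alpha,\beta,\gamma)\in\mathbb F_q^3\setminus\{0\}$ with $S(\alpha,\beta,\gamma)=\varepsilon p^{(m+j)/2}$ if $j\in\{0,2,4\}$, and with $S(\alpha,\beta,\gamma)=\varepsilon i\,p^{(m+j)/2}$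 if $j\in\{1,3\}$. Then: 1. $\mathcal C$ has exactly seven nonzero weights, namely $p^{m-1}(p-1)$ and $p^{m-1}(p-1)\pm\frac{p-1}{p}p^{(m+j)/2}$ for $j=0,2,4$. 2. For $j=1,3$ one has $n_{1,j}=n_{-1,j}=:n_j$, and the frequencies are $A_{p^{m-1}(p-1)}=2(n_1+n_3)$ and $A_{p^{m-1}(p-1)-\varepsilon\frac{p-1}{p}p^{(m+j)/2}}=n_{\varepsilon,j}$ for $\varepsilon=\pm1$ and $j=0,2,4$. 3. Explicitly, for $\varepsilon=\pm1$, $$n_{\varepsilon,0}=-\frac{b+\varepsilon c_6-ap^2-ap^3-ap^4-ap^5-bp^2+c_1p^6+\varepsilon c_2p^6+c_3p^3+c_3p^5-\varepsilon c_4p^2-\varepsilon c_4p^4+c_5p^2}{-2p^6+2p^4+2p^2-2},$$ $$n_{\varepsilon,2}=\frac{\varepsilon c_4-\varepsilon c_6+ap-c_5p+ap^2+ap^4+ap^5-c_1p^5-\varepsilon c_2p^4-c_3p^2-c_3p^4+\varepsilon c_4p^4}{2p^7-4p^5+2p^3},$$ $$n_{\varepsilon,4}=-\frac{b+\varepsilon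 c_4-c_5-\varepsilon c_6+ap-c_3p+ap^2+ap^3+ap^4-bp^2-c_1p^4-\varepsilon c_2p^2-c_3p^3+\varepsilon c_4p^2}{2p^{10}-2p^8-2p^6+2p^4},$$ $$2n_1=\frac{-(b-c_5+ap^3-c_3p^3)}{p^2-p^4},\qquad 2n_3=\frac{b-c_5+ap-c_3p}{p^4-p^6},$$ where $$c_1=p^{3m}-1,\quad c_2=p^{m/2}(p^{2m}-1),\quad c_3=p^m(p^m-1),\quad c_4=(p+1)p^{3m/2}(p^m-1),$$ $$c_5=\left(8(p^m-1)^2-p^m+1\right)p^m,\quad c_6=\left(5(p^m-1)(8p^m-2p-10)-p^{2m}+1\right)p^{m/2},$$ $$A_2'=p^m-1,\qquad A_4'=\frac{(p^m-1)(2p^m-p-3)}{3}+\frac{(p^m-1)(p^m-3)}{2},$$ $$a=\frac{p^{3m-2}\left((p^m-1)(p^m-2)(p-1)^2+2A_2'\right)-p^{2(m-1)}(p-1)^2(p^{3m}-2p^{2m}+1)+(p-1)(p^m-1)p^{3m-1}}{(p-1)^2p^{m-2}},$$ $$\begin{aligned}b=\Big\{&p^{3m-4}\big[(p^m-1)(p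^m-2)(p^m-3)(p^m-4)(p-1)^4+12A_2'(p^m-3)(p^m-4)(p-1)^2+24A_4'\big]\\&-(p-1)^5p^{3(m-1)}a-p^{4(m-1)}(p-1)^4(p^{3m}-4p^{2m}-16p^m+19)\\&+6\big[(p-1)^3p^{2(m-1)}a+p^{3(m-1)}(p-1)^3(p^{3m}-p^{2m+1}-4p^m+6)\big]\\&-11\big[(p-1)^2p^{m-2}a+p^{2(m-1)}(p-1)^2(p^{3m}-2p^{2m}+1)\big]\\&+6(p-1)(p^m-1)p^{3m-1}\Big\}\Big/\left((p-1)^4p^{2m-4}\right).\end{aligned}$$ -/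

import Mathlib

/-- The cyclic code of length `l` over `K` with set of nonzeros `S ⊆ L`, where `L` is a finite
extension of `K` that contains a primitive `l`-th root of unity. It consists of the words `c` whose
polynomial `c(X) = ∑ cᵢ Xⁱ` vanishes at every `l`-th root of unity that is not conjugate over `K` to
an element of `S`; equivalently, it is the ideal of `K[X]/(X ^ l - 1)` generated by
`(X ^ l - 1) / h`, where `h` is the product of the distinct minimal polynomials of the elements
of `S`. -/
def cyclicCode (K : Type*) {L : Type*} [Field K] [Field L] [Algebra K L] (l : ℕ) (S : Set L) :
    Submodule K (Fin l → K) where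
  carrier := {c | ∀ z : L, z ^ l = 1 → (∀ s ∈ S, ¬ IsConjRoot K s z) →
    ∑ i : Fin l, algebraMap K L (c i) * z ^ (i : ℕ) = 0}
  zero_mem' := by
    intro z _ _
    simp
  add_mem' := by
    intro c d hc hd z hz hS
    simp only [Pi.add_apply, map_add, add_mul, Finset.sum_add_distrib]
    rw [hc z hz hS, hd z hz hS, add_zero]
  smul_mem' := by
    intro a c hc z hz hS
    simp only [Pi.smul_apply, smul_eq_mul, map_mul, mul_assoc, ← Finset.mul_sum]
    rw [hc z hz hS, mul_zero]

/-- The set of nonzero Hamming weights of the codewords of `C`, as rational numbers. -/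
def nonzeroWeights {K : Type*} [Field K] [DecidableEq K] {l : ℕ} (C : Submodule K (Fin l → K)) :
    Set ℚ :=
  {w | w ≠ 0 ∧ ∃ c ∈ C, (hammingNorm c : ℚ) = w}

/-- The number `A_w` of codewords of `C` of Hamming weight `w`. -/
noncomputable def weightFreq {K : Type*} [Field K] [DecidableEq K] {l : ℕ}
    (C : Submodule K (Fin l → K)) (w : ℚ) : ℕ :=
  {c : Fin l → K | c ∈ C ∧ (hammingNorm c : ℚ) = w}.ncard

/-- The exponential sum `S(α, β, γ) = ∑ x, ζ ^ Tr(α x ^ 2 + β x ^ (p + 1) + γ x ^ (p ^ 2 + 1))`,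
with `p = 3` and `ζ = exp (2 π i / 3)`. -/
noncomputable def expSum {F : Type*} [Field F] [Fintype F] [Algebra (ZMod 3) F] (α β γ : F) : ℂ :=
  ∑ x : F, ZMod.stdAddChar (Algebra.trace (ZMod 3) F
    (α * x ^ 2 + β * x ^ (3 + 1) + γ * x ^ (3 ^ 2 + 1)))

/-- The set `N_{ε,j}` of the nonzero triples `(α, β, γ)` with `S(α, β, γ) = ε p ^ ((m + j) / 2)` if
`j` is even and `S(α, β, γ) = ε i p ^ ((m + j) / 2)` if `j` is odd, where `p = 3` and the exponent
`(m + j) / 2` may be a half-integer. -/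
def expSumSet (F : Type*) [Field F] [Fintype F] [Algebra (ZMod 3) F] (m : ℕ) (ε : ℤ) (j : ℕ) :
    Set (F × F × F) :=
  {t | t ≠ 0 ∧ expSum t.1 t.2.1 t.2.2 =
    (ε : ℂ) * (if Even j then 1 else Complex.I) * ((Real.sqrt 3 : ℝ) : ℂ) ^ (m + j)}

/-- The number `n_{ε,j}` of elements of `N_{ε,j}`. -/
noncomputable def expSumCount (F : Type*) [Field F] [Fintype F] [Algebra (ZMod 3) F]
    (m : ℕ) (ε : ℤ) (j : ℕ) : ℕ :=
  (expSumSet F m ε j).ncard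

/-- The weight `p ^ (m - 1) (p - 1) - ε ((p - 1) / p) p ^ ((m + j) / 2)`, with `p = 3`, for `m` and
`j` even. For `ε = 0` it is the middle weight `p ^ (m - 1) (p - 1)`. -/
def codeWeight (m : ℕ) (ε : ℤ) (j : ℕ) : ℚ :=
  3 ^ (m - 1) * (3 - 1) - ε * ((3 - 1) / 3) * 3 ^ ((m + j) / 2)

namespace Explicit

/-! The constants below are used with `p = 3` and even `m ≥ 6`. -/

def dualA2 (p : ℚ) (m : ℕ) : ℚ := p ^ m - 1

def dualA4 (p : ℚ) (m : ℕ) : ℚ :=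
  (p ^ m - 1) * (2 * p ^ m - p - 3) / 3 + (p ^ m - 1) * (p ^ m - 3) / 2

def a (p : ℚ) (m : ℕ) : ℚ :=
  (p ^ (3 * m - 2) * ((p ^ m - 1) * (p ^ m - 2) * (p - 1) ^ 2 + 2 * dualA2 p m)
    - p ^ (2 * (m - 1)) * (p - 1) ^ 2 * (p ^ (3 * m) - 2 * p ^ (2 * m) + 1)
    + (p - 1) * (p ^ m - 1) * p ^ (3 * m - 1)) / ((p - 1) ^ 2 * p ^ (m - 2))

def b (p : ℚ) (m : ℕ) : ℚ :=
  (p ^ (3 * m - 4) * ((p ^ m - 1) * (p ^ m - 2) * (p ^ m - 3) * (p ^ m - 4) * (p - 1) ^ 4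
      + 12 * dualA2 p m * (p ^ m - 3) * (p ^ m - 4) * (p - 1) ^ 2 + 24 * dualA4 p m)
    - (p - 1) ^ 5 * p ^ (3 * (m - 1)) * a p m
    - p ^ (4 * (m - 1)) * (p - 1) ^ 4 *
        (p ^ (3 * m) - 4 * p ^ (2 * m) - 16 * p ^ m + 19)
    + 6 * ((p - 1) ^ 3 * p ^ (2 * (m - 1)) * a p m
      + p ^ (3 * (m - 1)) * (p - 1) ^ 3 *
          (p ^ (3 * m) - p ^ (2 * m + 1) - 4 * p ^ m + 6))
    - 11 * ((p - 1) ^ 2 * p ^ (m - 2) * a p m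
      + p ^ (2 * (m - 1)) * (p - 1) ^ 2 * (p ^ (3 * m) - 2 * p ^ (2 * m) + 1))
    + 6 * ((p - 1) * (p ^ m - 1) * p ^ (3 * m - 1))) / ((p - 1) ^ 4 * p ^ (2 * m - 4))

def c1 (p : ℚ) (m : ℕ) : ℚ := p ^ (3 * m) - 1

def c2 (p : ℚ) (m : ℕ) : ℚ := p ^ (m / 2) * (p ^ (2 * m) - 1)

def c3 (p : ℚ) (m : ℕ) : ℚ := p ^ m * (p ^ m - 1)

def c4 (p : ℚ) (m : ℕ) : ℚ := (p + 1) * p ^ (3 * m / 2) * (p ^ m - 1)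

def c5 (p : ℚ) (m : ℕ) : ℚ := (8 * (p ^ m - 1) ^ 2 - p ^ m + 1) * p ^ m

def c6 (p : ℚ) (m : ℕ) : ℚ :=
  (5 * (p ^ m - 1) * (8 * p ^ m - 2 * p - 10) - p ^ (2 * m) + 1) * p ^ (m / 2)

/-- The explicit value of `n_{ε,0}` for `ε = 1` and `ε = -1`. -/
def n0 (p : ℚ) (m : ℕ) (ε : ℤ) : ℚ :=
  -(b p m + ε * c6 p m - a p m * p ^ 2 - a p m * p ^ 3 - a p m * p ^ 4 - a p m * p ^ 5
      - b p m * p ^ 2 + c1 p m * p ^ 6 + ε * c2 p m * p ^ 6 + c3 p m * p ^ 3 + c3 p m * p ^ 5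
      - ε * c4 p m * p ^ 2 - ε * c4 p m * p ^ 4 + c5 p m * p ^ 2)
    / (-2 * p ^ 6 + 2 * p ^ 4 + 2 * p ^ 2 - 2)

/-- The explicit value of `2 n_1`. -/
def twoN1 (p : ℚ) (m : ℕ) : ℚ :=
  -(b p m - c5 p m + a p m * p ^ 3 - c3 p m * p ^ 3) / (p ^ 2 - p ^ 4)

/-- The explicit value of `n_{ε,2}` for `ε = 1` and `ε = -1`. -/
def n2 (p : ℚ) (m : ℕ) (ε : ℤ) : ℚ :=
  (ε * c4 p m - ε * c6 p m + a p m * p - c5 p m * p + a p m * p ^ 2 + a p m * p ^ 4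
      + a p m * p ^ 5 - c1 p m * p ^ 5 - ε * c2 p m * p ^ 4 - c3 p m * p ^ 2 - c3 p m * p ^ 4
      + ε * c4 p m * p ^ 4)
    / (2 * p ^ 7 - 4 * p ^ 5 + 2 * p ^ 3)

/-- The explicit value of `2 n_3`. -/
def twoN3 (p : ℚ) (m : ℕ) : ℚ :=
  (b p m - c5 p m + a p m * p - c3 p m * p) / (p ^ 4 - p ^ 6)

/-- The explicit value of `n_{ε,4}` for `ε = 1` and `ε = -1`. -/
def n4 (p : ℚ) (m : ℕ) (ε : ℤ) : ℚ :=
  -(b p m + ε * c4 p m - c5 p m - ε * c6 p m + a p m * p - c3 p m * p + a p m * p ^ 2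
      + a p m * p ^ 3 + a p m * p ^ 4 - b p m * p ^ 2 - c1 p m * p ^ 4 - ε * c2 p m * p ^ 2
      - c3 p m * p ^ 3 + ε * c4 p m * p ^ 2)
    / (2 * p ^ 10 - 2 * p ^ 8 - 2 * p ^ 6 + 2 * p ^ 4)

end Explicit

open scoped ComplexConjugate

set_option linter.unusedSectionVars false

/-! ### Additive characters of `F`, the exponential sum and its possible values. -/

section CharSums

variable {F : Type*} [Field F] [Fintype F] [Algebra (ZMod 3) F]

/-! Write `S(t)` for the exponential sum of the quadratic form `Tr (codePoly t x)`, and `q = 3 ^ m`.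

The values of `S`. For `t ≠ 0`, `|S(t)|²` is `q` times the size of the radical, and the radical lies
in the zero set of a nonzero polynomial of degree at most 81, so its size is `3 ^ j` with `j ≤ 4`
(`charSum_mul_conj`, `card_polarRadical`). The form is even in `x`, hence `S(t) = u + c λ` with
integers `u`, `c` and `λ = i √3`. The equation `u² + 3c² = 3 ^ (m + j)` then forces `S(t) = ±λ ^ (m
+ j)` (`charSum_eq_pow`). For even `m` this leaves ten values, and conjugation (`t ↦ -t`) pairs the
imaginary ones, so eight multiplicities are unknown.

The moments. By orthogonality (`sum_charSum`), the sum over `t` of a product of copies of `S` and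
its conjugate is `q³` times the number of solutions of a system in `x²`, `x⁴`, `x¹⁰`. In the
variables `u = x²` these are the power sums of degrees 1, 2, 5, and Newton's identities in
characteristic 3 make all the required systems solvable by hand. The moments of `S`, `S³`, `S⁵`
determine the differences of the real multiplicities. The moments of `1`, `S²`, `S⁴`, `|S|²`, `S³
conj S` determine their sums and the imaginary multiplicities; the factors `conj S` are what
separates real values from imaginary ones.

The code. Its words are exactly the trace words `i ↦ Tr (f (π ^ i))` (`cyclicCode_eq_range`), and
the weight is an affine function of `Re S` (`three_mul_hammingNorm`). Thus the value distribution of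
`S` is the weight distribution, with the two imaginary levels merging into the middle weight. All
seven weights occur because the relevant multiplicities are positive for `m ≥ 6`. -/

variable (F) in
lemma charP_three : CharP F 3 :=
  charP_of_injective_algebraMap (algebraMap (ZMod 3) F).injective 3

variable (F) in
lemma three_eq_zero : (3 : F) = 0 := by
  have := charP_three F
  exact_mod_cast CharP.cast_eq_zero F 3

lemma two_ne_zero_of_charThree : (2 : F) ≠ 0 := by
  intro h2
  have : (1 : F) = 0 := by linear_combination three_eq_zero F - h2
  exact one_ne_zero this

variable (F) in
/-- The canonical additive character `x ↦ ζ ^ Tr x`. -/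
noncomputable def traceChar : AddChar F ℂ :=
  ZMod.stdAddChar.compAddMonoidHom (Algebra.trace (ZMod 3) F).toAddMonoidHom

lemma traceChar_apply (x : F) :
    traceChar F x = ZMod.stdAddChar (Algebra.trace (ZMod 3) F x) := rfl

lemma traceChar_eq_one_iff (x : F) : traceChar F x = 1 ↔ Algebra.trace (ZMod 3) F x = 0 := by
  rw [traceChar_apply]
  constructor
  · intro h
    apply ZMod.injective_stdAddChar
    rw [h, AddChar.map_zero_eq_one]
  · intro h
    rw [h, AddChar.map_zero_eq_one]

variable (F) in
lemma traceChar_isPrimitive : (traceChar F).IsPrimitive := by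
  apply AddChar.IsPrimitive.of_ne_one
  intro h
  obtain ⟨x, hx⟩ := Algebra.trace_surjective (ZMod 3) F 1
  have h1 : traceChar F x = 1 := by rw [h]; rfl
  rw [traceChar_eq_one_iff, hx] at h1
  exact absurd h1 (by decide)

lemma sum_traceChar_mul [DecidableEq F] (b : F) :
    ∑ x : F, traceChar F (x * b) = if b = 0 then (Fintype.card F : ℂ) else 0 := by
  have := AddChar.sum_mulShift b (traceChar_isPrimitive F)
  rw [this]; split_ifs <;> simp

lemma trace_pow_three (x : F) :
    Algebra.trace (ZMod 3) F (x ^ 3) = Algebra.trace (ZMod 3) F x := by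
  have h := Algebra.trace_eq_of_algEquiv
    (FiniteField.frobeniusAlgEquivOfAlgebraic (ZMod 3) F) x
  simpa [FiniteField.frobeniusAlgEquivOfAlgebraic, ZMod.card] using h

lemma traceChar_pow_three (x : F) : traceChar F (x ^ 3) = traceChar F x := by
  rw [traceChar_apply, trace_pow_three, traceChar_apply]

lemma traceChar_pow_nine (x : F) : traceChar F (x ^ 9) = traceChar F x := by
  rw [show x ^ 9 = (x ^ 3) ^ 3 by ring, traceChar_pow_three, traceChar_pow_three]

/-- The exponential sum of a family of triples `f`, evaluated at the coefficients `t`. -/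
noncomputable def charSum {X : Type*} [Fintype X] (f : X → F × F × F) (t : F × F × F) : ℂ :=
  ∑ x, traceChar F (t.1 * (f x).1 + t.2.1 * (f x).2.1 + t.2.2 * (f x).2.2)

lemma charSum_mul {X Y : Type*} [Fintype X] [Fintype Y] (f : X → F × F × F)
    (g : Y → F × F × F) (t : F × F × F) :
    charSum f t * charSum g t = charSum (fun z : X × Y => f z.1 + g z.2) t := by
  simp only [charSum, Finset.sum_mul_sum, Fintype.sum_prod_type]
  refine Finset.sum_congr rfl fun x _ => Finset.sum_congr rfl fun y _ => ?_
  rw [← AddChar.map_add_eq_mul]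
  congr 1
  simp only [Prod.fst_add, Prod.snd_add]
  ring

lemma conj_charSum {X : Type*} [Fintype X] (f : X → F × F × F) (t : F × F × F) :
    conj (charSum f t) = charSum (fun x => -f x) t := by
  simp only [charSum, map_sum]
  refine Finset.sum_congr rfl fun x _ => ?_
  rw [← AddChar.map_neg_eq_conj]
  congr 1
  simp only [Prod.fst_neg, Prod.snd_neg]
  ring

lemma charSum_neg {X : Type*} [Fintype X] (f : X → F × F × F) (t : F × F × F) :
    charSum f (-t) = conj (charSum f t) := by
  rw [conj_charSum]
  simp [charSum]

/-- Orthogonality of characters in each of the three coefficients. Combined with `charSum_mul` and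
`conj_charSum`, it turns every moment into a count of solutions. -/
lemma sum_charSum {X : Type*} [Fintype X] [DecidableEq F] (f : X → F × F × F) :
    ∑ t, charSum f t =
      (Fintype.card F : ℂ) ^ 3 * ((Finset.univ.filter fun x => f x = 0).card : ℂ) := by
  simp only [charSum]
  rw [Finset.sum_comm]
  have key : ∀ x, ∑ t : F × F × F,
      traceChar F (t.1 * (f x).1 + t.2.1 * (f x).2.1 + t.2.2 * (f x).2.2) =
      if f x = 0 then (Fintype.card F : ℂ) ^ 3 else 0 := by
    intro x
    simp only [Fintype.sum_prod_type, AddChar.map_add_eq_mul, ← Finset.mul_sum,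
      ← Finset.sum_mul, sum_traceChar_mul, Prod.ext_iff, Prod.fst_zero, Prod.snd_zero]
    split_ifs <;> simp_all
    ring
  rw [Finset.sum_congr rfl fun x _ => key x, ← Finset.sum_filter, Finset.sum_const, nsmul_eq_mul,
    mul_comm]

/-- The triple `(x ^ 2, x ^ 4, x ^ 10)`. -/
def powTriple (x : F) : F × F × F := (x ^ 2, x ^ 4, x ^ 10)

lemma charSum_powTriple_zero : charSum (powTriple (F := F)) 0 = Fintype.card F := by
  simp [charSum]

/-! ### The absolute value of the exponential sum -/

/-- The polynomial function `α x ^ 2 + β x ^ 4 + γ x ^ 10`. -/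
def codePoly (t : F × F × F) (x : F) : F := t.1 * x ^ 2 + t.2.1 * x ^ 4 + t.2.2 * x ^ 10

/-- The polarization of `codePoly`. -/
def polarForm (t : F × F × F) (h y : F) : F :=
  t.1 * (2 * h * y) + t.2.1 * (h ^ 3 * y + h * y ^ 3) + t.2.2 * (h ^ 9 * y + h * y ^ 9)

lemma charSum_powTriple (t : F × F × F) :
    charSum powTriple t = ∑ x, traceChar F (codePoly t x) := rfl

lemma codePoly_neg (t : F × F × F) (x : F) : codePoly t (-x) = codePoly t x := by
  simp only [codePoly]; ring

lemma add_pow_three (x y : F) : (x + y) ^ 3 = x ^ 3 + y ^ 3 := by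
  have := charP_three F
  exact add_pow_char x y 3

lemma add_pow_nine (x y : F) : (x + y) ^ 9 = x ^ 9 + y ^ 9 := by
  rw [show (x + y) ^ 9 = ((x + y) ^ 3) ^ 3 by ring, add_pow_three, add_pow_three]; ring

lemma codePoly_add (t : F × F × F) (h y : F) :
    codePoly t (h + y) = codePoly t h + codePoly t y + polarForm t h y := by
  have h4 : (h + y) ^ 4 = (h ^ 3 + y ^ 3) * (h + y) := by rw [← add_pow_three]; ring
  have h10 : (h + y) ^ 10 = (h ^ 9 + y ^ 9) * (h + y) := by rw [← add_pow_nine]; ring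
  simp only [codePoly, polarForm, h4, h10]
  ring

lemma polarForm_add_right (t : F × F × F) (h y z : F) :
    polarForm t h (y + z) = polarForm t h y + polarForm t h z := by
  simp only [polarForm, add_pow_three, add_pow_nine]; ring

lemma polarForm_comm (t : F × F × F) (h y : F) : polarForm t h y = polarForm t y h := by
  simp only [polarForm]; ring

lemma polarForm_zero_right (t : F × F × F) (h : F) : polarForm t h 0 = 0 := by
  simp [polarForm]

lemma polarForm_neg_left (t : F × F × F) (h y : F) : polarForm t (-h) y = -polarForm t h y := by
  simp only [polarForm]; ring

lemma polarForm_self (t : F × F × F) (h : F) : polarForm t h h = -codePoly t h := by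
  simp only [polarForm, codePoly]
  linear_combination (t.1 * h ^ 2 + t.2.1 * h ^ 4 + t.2.2 * h ^ 10) * three_eq_zero F

/-- The additive character `y ↦ ψ (B (h, y))`. -/
noncomputable def polarChar (t : F × F × F) (h : F) : AddChar F ℂ where
  toFun y := traceChar F (polarForm t h y)
  map_zero_eq_one' := by rw [polarForm_zero_right, AddChar.map_zero_eq_one]
  map_add_eq_mul' y z := by rw [polarForm_add_right, AddChar.map_add_eq_mul]

lemma polarChar_apply (t : F × F × F) (h y : F) :
    polarChar t h y = traceChar F (polarForm t h y) := rfl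

/-- The radical of the quadratic form `x ↦ Tr (α x ^ 2 + β x ^ 4 + γ x ^ 10)`. -/
noncomputable def polarRadical (t : F × F × F) : AddSubgroup F where
  carrier := {h | polarChar t h = 1}
  zero_mem' := by
    ext y
    simp [polarChar_apply, polarForm_comm t 0 y, polarForm_zero_right]
  add_mem' := by
    intro g h hg hh
    ext y
    have h1 := DFunLike.congr_fun hg y
    have h2 := DFunLike.congr_fun hh y
    simp only [polarChar_apply, AddChar.one_apply] at h1 h2 ⊢
    rw [polarForm_comm, polarForm_add_right, AddChar.map_add_eq_mul, polarForm_comm t y g,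
      polarForm_comm t y h, h1, h2, one_mul]
  neg_mem' := by
    intro h hh
    ext y
    have h2 := DFunLike.congr_fun hh y
    simp only [polarChar_apply, AddChar.one_apply] at h2 ⊢
    rw [polarForm_neg_left, AddChar.map_neg_eq_inv, h2, inv_one]

lemma mem_polarRadical {t : F × F × F} {h : F} : h ∈ polarRadical t ↔ polarChar t h = 1 := Iff.rfl

/-- Differencing: after the substitution `x = h + y`, the sum over `y` is a sum of the character
`polarChar t h`, which vanishes unless `h` is in the radical. -/
lemma charSum_mul_conj (t : F × F × F) :
    charSum powTriple t * conj (charSum powTriple t) =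
      Fintype.card F * Nat.card (polarRadical t) := by
  classical
  have h1 : charSum powTriple t * conj (charSum powTriple t) =
      ∑ y, ∑ h, traceChar F (codePoly t (h + y)) * traceChar F (-codePoly t y) := by
    rw [charSum_powTriple, map_sum, Finset.sum_mul_sum, Finset.sum_comm]
    refine Finset.sum_congr rfl fun y _ => ?_
    rw [← Equiv.sum_comp (Equiv.addRight y)]
    refine Finset.sum_congr rfl fun h _ => ?_
    rw [AddChar.map_neg_eq_conj]
    rfl
  rw [h1, Finset.sum_comm]
  have h2 : ∀ h : F, ∑ y, traceChar F (codePoly t (h + y)) * traceChar F (-codePoly t y) =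
      if h ∈ polarRadical t then (Fintype.card F : ℂ) else 0 := by
    intro h
    have h3 : ∀ y, traceChar F (codePoly t (h + y)) * traceChar F (-codePoly t y) =
        traceChar F (codePoly t h) * polarChar t h y := by
      intro y
      rw [polarChar_apply, ← AddChar.map_add_eq_mul, ← AddChar.map_add_eq_mul, codePoly_add]
      congr 1; ring
    rw [Finset.sum_congr rfl fun y _ => h3 y, ← Finset.mul_sum, AddChar.sum_eq_ite,
      mem_polarRadical]
    -- The trivial character is the `0` of the additive notation for characters and the `1` of the
    -- multiplicative one.
    have h0 : polarChar t h = 0 ↔ polarChar t h = 1 := Iff.rfl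
    simp only [h0]
    split_ifs with hh
    -- Evaluating at `y = h`: since `B(h, h) = 2 Q(h) = -Q(h)`, the form is trivial on its radical.
    · have h4 := DFunLike.congr_fun hh h
      rw [polarChar_apply, polarForm_self, AddChar.map_neg_eq_inv] at h4
      have h5 : traceChar F (codePoly t h) = 1 := by simpa using h4
      rw [h5, one_mul]
    · simp
  rw [Finset.sum_congr rfl fun h _ => h2 h, ← Finset.sum_filter, Finset.sum_const, nsmul_eq_mul,
    mul_comm, Nat.card_eq_fintype_card, Fintype.card_subtype]

/-- The radical is contained in the zero set of this polynomial. -/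
noncomputable def radicalPoly (t : F × F × F) : Polynomial F :=
  .C (t.2.2 ^ 9) * .X ^ 81 + .C (t.2.1 ^ 9) * .X ^ 27 + .C (2 * t.1 ^ 9) * .X ^ 9 +
    .C (t.2.1 ^ 3) * .X ^ 3 + .C t.2.2 * .X ^ 1

lemma radicalPoly_ne_zero {t : F × F × F} (ht : t ≠ 0) : radicalPoly t ≠ 0 := by
  intro h
  apply ht
  have h81 := congrArg (fun p => p.coeff 81) h
  have h27 := congrArg (fun p => p.coeff 27) h
  have h9 := congrArg (fun p => p.coeff 9) h
  simp only [radicalPoly, Polynomial.coeff_add, Polynomial.coeff_C_mul, Polynomial.coeff_X_pow,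
    Polynomial.coeff_zero] at h81 h27 h9
  norm_num at h81 h27 h9
  have h2 : (2 : F) ≠ 0 := two_ne_zero_of_charThree
  simp only [Prod.ext_iff, Prod.fst_zero, Prod.snd_zero]
  exact ⟨by tauto, h27, h81⟩

lemma natDegree_radicalPoly_le (t : F × F × F) : (radicalPoly t).natDegree ≤ 81 := by
  unfold radicalPoly
  compute_degree

/-- The trace is invariant under Frobenius, so each term of the polar form can be raised to the
power 1, 3 or 9 that makes it a multiple of `y ^ 9`. The common cofactor is the polynomial, and
nondegeneracy of the trace kills it because `y ^ 9` runs over all of `F`. -/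
lemma radicalPoly_eval {t : F × F × F} {h : F} (hh : h ∈ polarRadical t) :
    (radicalPoly t).eval h = 0 := by
  have := charP_three F
  have key : ∀ z, traceChar F ((radicalPoly t).eval h * z) = 1 := by
    intro z
    obtain ⟨w, hw⟩ := (frobeniusEquiv F 3).surjective z
    obtain ⟨y, hy⟩ := (frobeniusEquiv F 3).surjective w
    have hz : z = y ^ 9 := by
      rw [← hw, ← hy]; simp only [frobeniusEquiv_apply, frobenius_def]; ring
    have h1 := DFunLike.congr_fun hh y
    rw [polarChar_apply, AddChar.one_apply] at h1
    have e2 : (2 : F) ^ 9 = 2 := by linear_combination 170 * three_eq_zero F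
    rw [← h1, hz]
    have e : (radicalPoly t).eval h * y ^ 9 =
        (t.1 * (2 * h * y)) ^ 9 + (t.2.1 * h ^ 3 * y) ^ 9 + (t.2.1 * h * y ^ 3) ^ 3 +
        (t.2.2 * h ^ 9 * y) ^ 9 + t.2.2 * h * y ^ 9 := by
      simp only [radicalPoly, Polynomial.eval_add, Polynomial.eval_mul, Polynomial.eval_C,
        Polynomial.eval_pow, Polynomial.eval_X]
      linear_combination (-t.1 ^ 9 * h ^ 9 * y ^ 9) * e2
    rw [e]
    simp only [AddChar.map_add_eq_mul, traceChar_pow_nine, traceChar_pow_three]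
    simp only [← AddChar.map_add_eq_mul]
    congr 1
    simp only [polarForm]; ring
  by_contra hne
  refine traceChar_isPrimitive F hne ?_
  ext z
  simpa [AddChar.mulShift_apply] using key z

lemma card_polarRadical {m : ℕ} (hF : Fintype.card F = 3 ^ m) {t : F × F × F} (ht : t ≠ 0) :
    ∃ j ≤ 4, Nat.card (polarRadical t) = 3 ^ j := by
  classical
  have h1 : Nat.card (polarRadical t) ∣ 3 ^ m := by
    rw [← hF, ← Nat.card_eq_fintype_card]
    exact AddSubgroup.card_addSubgroup_dvd_card _
  obtain ⟨j, -, hj⟩ := (Nat.dvd_prime_pow Nat.prime_three).1 h1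
  refine ⟨j, ?_, hj⟩
  have h2 : Nat.card (polarRadical t) ≤ 81 := by
    have h3 : (Finset.univ.filter fun h => h ∈ polarRadical t) ⊆ (radicalPoly t).roots.toFinset := by
      intro h hh
      simp only [Finset.mem_filter, Finset.mem_univ, true_and] at hh
      rw [Multiset.mem_toFinset, Polynomial.mem_roots (radicalPoly_ne_zero ht)]
      exact radicalPoly_eval hh
    calc Nat.card (polarRadical t) = (Finset.univ.filter fun h => h ∈ polarRadical t).card := by
          rw [Nat.card_eq_fintype_card, Fintype.card_subtype]
      _ ≤ _ := Finset.card_le_card h3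
      _ ≤ _ := Multiset.toFinset_card_le _
      _ ≤ _ := Polynomial.card_roots' _
      _ ≤ 81 := natDegree_radicalPoly_le t
  rw [hj] at h2
  exact (Nat.pow_le_pow_iff_right (by norm_num : 1 < 3)).1 (by simpa using h2)

/-! ### The argument of the exponential sum -/

/-- Descent on `n`: the equation forces `u = 3v`, and then `3v + c λ = λ (c - v λ)`, whose second
factor has norm `3 ^ n`. -/
lemma eq_pow_of_sq_add_three_mul_sq (lam : ℂ) (hlam : lam ^ 2 = -3) :
    ∀ (n : ℕ) (u c : ℤ), u ^ 2 + 3 * c ^ 2 = 3 ^ n →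
      (u + c * lam : ℂ) = lam ^ n ∨ (u + c * lam : ℂ) = -lam ^ n := by
  intro n
  induction n with
  | zero =>
    intro u c h
    have hc : c = 0 := by
      by_contra hc
      have : 0 < c ^ 2 := by positivity
      nlinarith [sq_nonneg u]
    subst hc
    have hu : u ^ 2 = 1 := by linarith
    rcases sq_eq_one_iff.1 hu with h | h <;> simp [h]
  | succ n ih =>
    intro u c h
    have h3 : (3 : ℤ) ∣ u := by
      apply Int.prime_three.dvd_of_dvd_pow (n := 2)
      exact ⟨3 ^ n - c ^ 2, by rw [pow_succ 3] at h; linarith⟩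
    obtain ⟨v, rfl⟩ := h3
    have h' : c ^ 2 + 3 * (-v) ^ 2 = 3 ^ n := by rw [pow_succ 3] at h; linarith
    rcases ih c (-v) h' with h1 | h1
    · left
      rw [pow_succ, ← h1]; push_cast
      linear_combination v * hlam
    · right
      rw [pow_succ, ← neg_mul, ← h1]; push_cast
      linear_combination v * hlam

/-- The number of `x` with `Tr (α x ^ 2 + β x ^ 4 + γ x ^ 10) = i`. -/
noncomputable def valueCount (t : F × F × F) (i : ZMod 3) : ℕ :=
  (Finset.univ.filter fun x : F => Algebra.trace (ZMod 3) F (codePoly t x) = i).card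

lemma sum_valueCount (t : F × F × F) :
    valueCount t 0 + valueCount t 1 + valueCount t 2 = Fintype.card F := by
  have h := Finset.card_eq_sum_card_fiberwise (s := (Finset.univ : Finset F))
    (t := (Finset.univ : Finset (ZMod 3)))
    (f := fun x => Algebra.trace (ZMod 3) F (codePoly t x)) (fun _ _ => by simp)
  rw [Finset.card_univ] at h
  rw [h]
  exact (Fin.sum_univ_three (fun i : Fin 3 => valueCount t i)).symm

/-- The involution `x ↦ -x` preserves each level set, and its only fixed point `0` has value `0`.
The parity removes the denominators 2 in `charSum_eq_valueCount`. -/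
lemma even_valueCount (t : F × F × F) {i : ZMod 3} (hi : i ≠ 0) : Even (valueCount t i) := by
  classical
  unfold valueCount
  rw [← ZMod.natCast_eq_zero_iff_even, Finset.cast_card]
  refine Finset.sum_involution (fun x _ => -x) ?_ ?_ ?_ ?_
  · intros; decide
  · intro x hx _ hxx
    have hx0 : x = 0 := by
      have : 2 * x = 0 := by linear_combination -hxx
      exact (mul_eq_zero.1 this).resolve_left two_ne_zero_of_charThree
    subst hx0
    simp [codePoly] at hx
    exact hi hx.symm
  · intro x hx
    simpa [codePoly_neg] using hx
  · intros; simp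

lemma stdAddChar_one_three : ZMod.stdAddChar (1 : ZMod 3) = (-1 + Complex.I * (√3 : ℝ)) / 2 := by
  have h := ZMod.stdAddChar_coe (N := 3) 1
  rw [Int.cast_one] at h
  rw [h]
  have e : 2 * (Real.pi : ℂ) * Complex.I * ((1 : ℤ) : ℂ) / ((3 : ℕ) : ℂ) =
      ((Real.pi - Real.pi / 3 : ℝ) : ℂ) * Complex.I := by push_cast; ring
  rw [e, Complex.exp_mul_I, ← Complex.ofReal_cos, ← Complex.ofReal_sin, Real.cos_pi_sub,
    Real.sin_pi_sub, Real.cos_pi_div_three, Real.sin_pi_div_three]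
  push_cast; ring

lemma sqrt_three_sq : ((√3 : ℝ) : ℂ) ^ 2 = 3 := by
  rw [← Complex.ofReal_pow, Real.sq_sqrt (by norm_num)]; norm_num

lemma stdAddChar_two_three : ZMod.stdAddChar (2 : ZMod 3) = (-1 - Complex.I * (√3 : ℝ)) / 2 := by
  rw [show (2 : ZMod 3) = 1 + 1 by decide, AddChar.map_add_eq_mul, stdAddChar_one_three]
  linear_combination (1 / 4 : ℂ) * (Complex.I ^ 2 * sqrt_three_sq + 3 * Complex.I_sq)

lemma charSum_eq_valueCount (t : F × F × F) : charSum powTriple t =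
    valueCount t 0 - (valueCount t 1 + valueCount t 2) / 2 +
      (valueCount t 1 - valueCount t 2) / 2 * (Complex.I * (√3 : ℝ)) := by
  have h : charSum powTriple t = ∑ i : ZMod 3, valueCount t i * ZMod.stdAddChar i := by
    rw [charSum_powTriple]
    rw [← Finset.sum_fiberwise (g := fun x => Algebra.trace (ZMod 3) F (codePoly t x))]
    refine Finset.sum_congr rfl fun i _ => ?_
    rw [Finset.sum_congr rfl (g := fun _ => (ZMod.stdAddChar i : ℂ)), Finset.sum_const,
      nsmul_eq_mul, valueCount]
    intro x hx
    rw [traceChar_apply, (Finset.mem_filter.1 hx).2]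
  rw [h]
  have h3 : ∑ i : ZMod 3, (valueCount t i * ZMod.stdAddChar i : ℂ) =
      valueCount t 0 * ZMod.stdAddChar (0 : ZMod 3) + valueCount t 1 * ZMod.stdAddChar (1 : ZMod 3)
        + valueCount t 2 * ZMod.stdAddChar (2 : ZMod 3) :=
    Fin.sum_univ_three (fun i : Fin 3 => (valueCount t i * ZMod.stdAddChar (N := 3) i : ℂ))
  rw [h3, AddChar.map_zero_eq_one, stdAddChar_one_three, stdAddChar_two_three]
  ring

lemma re_charSum (t : F × F × F) : (charSum powTriple t).re =
    valueCount t 0 - (valueCount t 1 + valueCount t 2) / 2 := by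
  rw [charSum_eq_valueCount]
  have h : ((valueCount t 0 : ℂ) - (valueCount t 1 + valueCount t 2) / 2 +
      (valueCount t 1 - valueCount t 2) / 2 * (Complex.I * (√3 : ℝ))) =
      ((valueCount t 0 - (valueCount t 1 + valueCount t 2) / 2 : ℝ) : ℂ) +
        (((valueCount t 1 - valueCount t 2) / 2 * √3 : ℝ) : ℂ) * Complex.I := by
    push_cast; ring
  rw [h, Complex.add_re, Complex.ofReal_re, Complex.re_ofReal_mul, Complex.I_re, mul_zero, add_zero]

/-- The exponential sum of a nonzero triple is, up to sign, a power of `i √3`. -/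
lemma charSum_eq_pow {m : ℕ} (hF : Fintype.card F = 3 ^ m) {t : F × F × F} (ht : t ≠ 0) :
    ∃ j ≤ 4, charSum powTriple t = (Complex.I * (√3 : ℝ)) ^ (m + j) ∨
      charSum powTriple t = -(Complex.I * (√3 : ℝ)) ^ (m + j) := by
  obtain ⟨j, hj, hcard⟩ := card_polarRadical hF ht
  refine ⟨j, hj, ?_⟩
  obtain ⟨c₁, h1⟩ := even_valueCount t (i := 1) (by decide)
  obtain ⟨c₂, h2⟩ := even_valueCount t (i := 2) (by decide)
  have hS : charSum powTriple t = (((valueCount t 0 : ℤ) - c₁ - c₂ : ℤ) : ℂ) +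
      (((c₁ : ℤ) - c₂ : ℤ) : ℂ) * (Complex.I * (√3 : ℝ)) := by
    rw [charSum_eq_valueCount, h1, h2]; push_cast; ring
  have hlam : (Complex.I * (√3 : ℝ)) ^ 2 = -3 := by
    rw [mul_pow, sqrt_three_sq, Complex.I_sq]; ring
  rw [hS]
  apply eq_pow_of_sq_add_three_mul_sq _ hlam
  have hn := charSum_mul_conj t
  rw [hcard, hF, hS] at hn
  have : ((((valueCount t 0 : ℤ) - c₁ - c₂) ^ 2 + 3 * ((c₁ : ℤ) - c₂) ^ 2 : ℤ) : ℂ) =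
      ((3 ^ (m + j) : ℤ) : ℂ) := by
    push_cast at hn ⊢
    rw [pow_add, ← hn]
    simp only [map_add, map_sub, map_mul, Complex.conj_I, Complex.conj_ofReal, map_natCast]
    linear_combination ((c₁ - c₂ : ℂ) ^ 2) * hlam
  exact_mod_cast this

end CharSums

/-! ### Solutions of the power-sum systems, and the moments they give. -/

section Counting

variable {F : Type*} [Field F] [Fintype F] [Algebra (ZMod 3) F]

/-! ### Power sum identities in characteristic three -/

/-- The first two elementary symmetric functions vanish, so `u`, `v`, `w` are the roots of `X ^ 3 -
uvw`, which is a cube in characteristic 3. -/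
lemma eq_of_sum_eq_zero_of_sum_sq_eq_zero {u v w : F} (h1 : u + v + w = 0)
    (h2 : u ^ 2 + v ^ 2 + w ^ 2 = 0) : v = u ∧ w = u := by
  obtain rfl : w = -(u + v) := by linear_combination h1
  have h3 : (v - u) ^ 2 = 0 := by
    linear_combination (u ^ 2 + v ^ 2) * three_eq_zero F - h2
  have h4 : v = u := by
    have := pow_eq_zero_iff (two_ne_zero) |>.1 h3
    linear_combination this
  exact ⟨h4, by rw [h4]; linear_combination -u * three_eq_zero F⟩

/-- Newton's identity: when `e₁ = e₂ = 0`, the fifth power sum is `5 e₅`, and `e₅ = 0` for four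
variables. Hence the equation in `x ^ 10` is redundant in the fourth moment. -/
lemma sum_pow_five_eq_zero {u v w t : F} (h1 : u + v + (w + t) = 0)
    (h2 : u ^ 2 + v ^ 2 + (w ^ 2 + t ^ 2) = 0) : u ^ 5 + v ^ 5 + (w ^ 5 + t ^ 5) = 0 := by
  obtain rfl : t = -(u + v + w) := by linear_combination h1
  linear_combination (u ^ 5 + v ^ 5 + w ^ 5 + (-(u + v + w)) ^ 5) * three_eq_zero F -
    5 * (u * v * w - (u * v + u * w + v * w) * (u + v + w)) * h2

/-- The same identity with five variables: the fifth power sum is `5 e₅`, and 5 is invertible in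
characteristic 3. -/
lemma prod_eq_zero_of_power_sums {u v w t r : F} (h1 : u + v + w + t + r = 0)
    (h2 : u ^ 2 + v ^ 2 + w ^ 2 + t ^ 2 + r ^ 2 = 0)
    (h5 : u ^ 5 + v ^ 5 + w ^ 5 + t ^ 5 + r ^ 5 = 0) : u * v * w * t * r = 0 := by
  obtain rfl : r = -(u + v + w + t) := by linear_combination h1
  linear_combination 2 * h5 - 5 * (u * v * w + u * v * t + u * w * t + v * w * t -
    (u * v + u * w + u * t + v * w + v * t + w * t) * (u + v + w + t)) * h2 -
    3 * (u * v * w * t * (-(u + v + w + t))) * three_eq_zero F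

/-- The first two equations give `e₂ = 0`; then the fifth power sum is `t ^ 5 + 5 e₃ t ^ 2`, so `e₃
= 0` and the three elements are the roots of `X ^ 3 - t X ^ 2`. -/
lemma two_eq_zero_of_power_sums {u v w t : F} (h1 : u + v + w = t)
    (h2 : u ^ 2 + v ^ 2 + w ^ 2 = t ^ 2) (h5 : u ^ 5 + v ^ 5 + w ^ 5 = t ^ 5) (ht : t ≠ 0) :
    (u = t ∧ v = 0 ∧ w = 0) ∨ (u = 0 ∧ v = t ∧ w = 0) ∨ (u = 0 ∧ v = 0 ∧ w = t) := by
  have e2 : u * v + u * w + v * w = 0 := by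
    linear_combination (u * v + u * w + v * w) * three_eq_zero F - (u + v + w + t) * h1 + h2
  have e3 : u * v * w * t ^ 2 = 0 := by
    subst h1
    linear_combination 2 * h5 - 3 * (u * v * w * (u + v + w) ^ 2) * three_eq_zero F +
     10 * ((u + v + w) ^ 3 + u * v * w - (u + v + w) * (u * v + u * w + v * w)) * e2
  have e3' : u * v * w = 0 := (mul_eq_zero.1 e3).resolve_right (pow_ne_zero 2 ht)
  rcases mul_eq_zero.1 e3' with h | rfl
  · rcases mul_eq_zero.1 h with rfl | rfl
    · have : v * w = 0 := by linear_combination e2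
      rcases mul_eq_zero.1 this with rfl | rfl
      · right; right; exact ⟨rfl, rfl, by linear_combination h1⟩
      · right; left; exact ⟨rfl, by linear_combination h1, rfl⟩
    · have : u * w = 0 := by linear_combination e2
      rcases mul_eq_zero.1 this with rfl | rfl
      · right; right; exact ⟨rfl, rfl, by linear_combination h1⟩
      · left; exact ⟨by linear_combination h1, rfl, rfl⟩
  · have : u * v = 0 := by linear_combination e2
    rcases mul_eq_zero.1 this with rfl | rfl
    · right; left; exact ⟨rfl, by linear_combination h1, rfl⟩
    · left; exact ⟨by linear_combination h1, rfl, rfl⟩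

/-! ### Elementary sums -/

lemma sum_ite_zero_const [DecidableEq F] (c : ℂ) :
    ∑ x : F, (if x = 0 then 1 else c) = 1 + c * (Fintype.card F - 1) := by
  have h : ∀ x : F, (if x = 0 then 1 else c) = (if x = 0 then 1 - c else 0) + c := by
    intro x; split_ifs <;> ring
  simp only [h, Finset.sum_add_distrib, Finset.sum_ite_eq', Finset.mem_univ, if_true,
    Finset.sum_const, Finset.card_univ, nsmul_eq_mul]
  ring

lemma ne_neg_self {x : F} (hx : x ≠ 0) : x ≠ -x := by
  intro h
  have : 2 * x = 0 := by linear_combination h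
  exact hx ((mul_eq_zero.1 this).resolve_left two_ne_zero_of_charThree)

lemma sum_ite_sq_eq [DecidableEq F] (x : F) :
    ∑ y : F, (if y ^ 2 = x ^ 2 then (1 : ℂ) else 0) = if x = 0 then 1 else 2 := by
  rw [← Finset.natCast_card_filter]
  split_ifs with hx
  · subst hx
    have : (Finset.univ.filter fun y : F => y ^ 2 = 0 ^ 2) = {0} := by ext; simp
    rw [this]; simp
  · have : (Finset.univ.filter fun y : F => y ^ 2 = x ^ 2) = {x, -x} := by
      ext y; simp [sq_eq_sq_iff_eq_or_eq_neg]
    rw [this, Finset.card_pair (ne_neg_self hx)]; norm_num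

lemma sum_ite_pow_four_eq [DecidableEq F] {z : F} (hz : z ^ 4 = -1) (x : F) :
    ∑ y : F, (if x ^ 4 + y ^ 4 = 0 then (1 : ℂ) else 0) = if x = 0 then 1 else 4 := by
  rw [← Finset.natCast_card_filter]
  split_ifs with hx
  · subst hx
    have : (Finset.univ.filter fun y : F => 0 ^ 4 + y ^ 4 = 0) = {0} := by ext; simp
    rw [this]; simp
  · have hz0 : z ≠ 0 := by rintro rfl; norm_num at hz
    have hw := mul_ne_zero hz0 hx
    have hi1 : z ^ 2 ≠ 1 := by
      intro h
      have h1 : (1 : F) = -1 := by rw [← hz]; linear_combination (-z ^ 2 - 1) * h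
      exact ne_neg_self one_ne_zero h1
    have hi2 : z ^ 2 ≠ -1 := by
      intro h
      have h1 : (1 : F) = -1 := by rw [← hz]; linear_combination (-z ^ 2 + 1) * h
      exact ne_neg_self one_ne_zero h1
    have : (Finset.univ.filter fun y : F => x ^ 4 + y ^ 4 = 0) =
        {z * x, -(z * x), z ^ 2 * (z * x), -(z ^ 2 * (z * x))} := by
      ext y
      simp only [Finset.mem_filter, Finset.mem_univ, true_and, Finset.mem_insert,
        Finset.mem_singleton]
      constructor
      · intro h
        have h4 : (y - z * x) * ((y - -(z * x)) * ((y - z ^ 2 * (z * x)) *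
            (y - -(z ^ 2 * (z * x))))) = 0 := by
          linear_combination h + (z ^ 4 * x ^ 4 - x ^ 4 - y ^ 2 * z ^ 2 * x ^ 2) * hz
        simpa only [mul_eq_zero, sub_eq_zero] using h4
      · rintro (rfl | rfl | rfl | rfl)
        · linear_combination x ^ 4 * hz
        · linear_combination x ^ 4 * hz
        · linear_combination x ^ 4 * (z ^ 8 - z ^ 4 + 1) * hz
        · linear_combination x ^ 4 * (z ^ 8 - z ^ 4 + 1) * hz
    rw [this]
    have e1 : z * x ≠ z ^ 2 * (z * x) := by
      intro h; exact hi1 (mul_right_cancel₀ hw (by linear_combination -h))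
    have e2 : z * x ≠ -(z ^ 2 * (z * x)) := by
      intro h; exact hi2 (mul_right_cancel₀ hw (by linear_combination h))
    have e3 : -(z * x) ≠ z ^ 2 * (z * x) := by
      intro h; exact hi2 (mul_right_cancel₀ hw (by linear_combination -h))
    have e4 : -(z * x) ≠ -(z ^ 2 * (z * x)) := fun h => e1 (neg_injective h)
    rw [Finset.card_insert_of_notMem, Finset.card_insert_of_notMem, Finset.card_pair]
    · norm_num
    · exact ne_neg_self (mul_ne_zero (pow_ne_zero 2 hz0) hw)
    · simp only [Finset.mem_insert, Finset.mem_singleton, not_or]; exact ⟨e3, e4⟩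
    · simp only [Finset.mem_insert, Finset.mem_singleton, not_or]
      exact ⟨ne_neg_self hw, e1, e2⟩

/-! ### Points on the intersection of the quadric and the quartic -/

/-- Eliminating `b = -cd / a` makes the quartic split, up to the factor `a ^ 4`, as `(a ^ 4 + c ^ 4)
(a ^ 4 + d ^ 4)`. Each factor has four roots, and inclusion–exclusion gives `4q + 4q - 16`. -/
lemma sum_quadric_quartic_of_ne_zero [DecidableEq F] {z : F} (hz : z ^ 4 = -1) {a : F}
    (ha : a ≠ 0) :
    ∑ b : F, ∑ c : F, ∑ d : F,
      (if a * b + c * d = 0 ∧ a ^ 4 + b ^ 4 + (c ^ 4 + d ^ 4) = 0 then (1 : ℂ) else 0) =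
      8 * Fintype.card F - 16 := by
  rw [Finset.sum_comm]
  have h : ∀ c : F, ∑ b : F, ∑ d : F,
      (if a * b + c * d = 0 ∧ a ^ 4 + b ^ 4 + (c ^ 4 + d ^ 4) = 0 then (1 : ℂ) else 0) =
      ∑ d : F, ((if a ^ 4 + c ^ 4 = 0 then (1 : ℂ) else 0) +
        (if a ^ 4 + d ^ 4 = 0 then (1 : ℂ) else 0) -
        (if a ^ 4 + c ^ 4 = 0 then (1 : ℂ) else 0) * (if a ^ 4 + d ^ 4 = 0 then (1 : ℂ) else 0)) := by
    intro c
    rw [Finset.sum_comm]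
    refine Finset.sum_congr rfl fun d _ => ?_
    have h1 : ∀ b : F, (a * b + c * d = 0 ∧ a ^ 4 + b ^ 4 + (c ^ 4 + d ^ 4) = 0) ↔
        (b = -(c * d) / a ∧ (a ^ 4 + c ^ 4 = 0 ∨ a ^ 4 + d ^ 4 = 0)) := by
      intro b
      rw [← mul_eq_zero, eq_div_iff ha]
      have key : a * b + c * d = 0 → (a ^ 4 + c ^ 4) * (a ^ 4 + d ^ 4) =
          a ^ 4 * (a ^ 4 + b ^ 4 + (c ^ 4 + d ^ 4)) := by
        intro h
        have h4 : (a * b) ^ 4 = (c * d) ^ 4 := by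
          rw [show a * b = -(c * d) by linear_combination h]; ring
        linear_combination -h4
      constructor
      · rintro ⟨h2, h3⟩
        exact ⟨by linear_combination h2, by rw [key h2, h3, mul_zero]⟩
      · rintro ⟨h2, h3⟩
        have h4 : a * b + c * d = 0 := by linear_combination h2
        rw [key h4] at h3
        exact ⟨h4, (mul_eq_zero.1 h3).resolve_left (pow_ne_zero 4 ha)⟩
    simp only [h1, ite_and, Finset.sum_ite_eq', Finset.mem_univ, if_true]
    split_ifs <;> simp_all
  simp only [h, Finset.sum_sub_distrib, Finset.sum_add_distrib, ← Finset.mul_sum,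
    ← Finset.sum_mul, sum_ite_pow_four_eq hz, Finset.sum_const, Finset.card_univ, nsmul_eq_mul,
    if_neg ha]
  ring

lemma sum_quadric_quartic_zero [DecidableEq F] {z : F} (hz : z ^ 4 = -1) :
    ∑ b : F, ∑ c : F, ∑ d : F,
      (if (0 : F) * b + c * d = 0 ∧ 0 ^ 4 + b ^ 4 + (c ^ 4 + d ^ 4) = 0 then (1 : ℂ) else 0) =
      8 * (Fintype.card F - 1) + 1 := by
  have h : ∀ b : F, ∑ c : F, ∑ d : F,
      (if (0 : F) * b + c * d = 0 ∧ 0 ^ 4 + b ^ 4 + (c ^ 4 + d ^ 4) = 0 then (1 : ℂ) else 0) =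
      ∑ c : F, ∑ d : F, ((if d = 0 then if b ^ 4 + c ^ 4 = 0 then (1 : ℂ) else 0 else 0) +
        (if c = 0 then if b ^ 4 + d ^ 4 = 0 then (1 : ℂ) else 0 else 0) -
        (if c = 0 then if d = 0 then if b = 0 then 1 else 0 else 0 else 0)) := by
    intro b
    refine Finset.sum_congr rfl fun c _ => Finset.sum_congr rfl fun d _ => ?_
    by_cases hc : c = 0 <;> by_cases hd : d = 0 <;> simp [hc, hd]
  have h2 : ∀ b : F, ∑ c : F, ∑ d : F,
      (if (0 : F) * b + c * d = 0 ∧ 0 ^ 4 + b ^ 4 + (c ^ 4 + d ^ 4) = 0 then (1 : ℂ) else 0) =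
      2 * (if b = 0 then 1 else 4) - (if b = 0 then 1 else 0) := by
    intro b
    rw [h]
    simp only [Finset.sum_sub_distrib, Finset.sum_add_distrib, Finset.sum_ite_eq',
      Finset.mem_univ, if_true, sum_ite_pow_four_eq hz]
    have h3 : ∀ c : F, ∑ d : F, (if c = 0 then if b ^ 4 + d ^ 4 = 0 then (1 : ℂ) else 0 else 0) =
        if c = 0 then ∑ d : F, (if b ^ 4 + d ^ 4 = 0 then (1 : ℂ) else 0) else 0 := by
      intro c; split_ifs <;> simp
    have h4 : ∀ c : F, ∑ d : F,
        (if c = 0 then if d = 0 then if b = 0 then (1 : ℂ) else 0 else 0 else 0) =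
        if c = 0 then if b = 0 then (1 : ℂ) else 0 else 0 := by
      intro c; split_ifs <;> simp
    simp only [h3, h4, Finset.sum_ite_eq', Finset.mem_univ, if_true, sum_ite_pow_four_eq hz]
    ring
  simp only [h2, Finset.sum_sub_distrib, ← Finset.mul_sum, sum_ite_zero_const,
    Finset.sum_ite_eq', Finset.mem_univ, if_true]
  ring

lemma sum_quadric_quartic [DecidableEq F] {z : F} (hz : z ^ 4 = -1) :
    ∑ a : F, ∑ b : F, ∑ c : F, ∑ d : F,
      (if a * b + c * d = 0 ∧ a ^ 4 + b ^ 4 + (c ^ 4 + d ^ 4) = 0 then (1 : ℂ) else 0) =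
      8 * (Fintype.card F - 1) ^ 2 + 1 := by
  have h : ∀ a : F, ∑ b : F, ∑ c : F, ∑ d : F,
      (if a * b + c * d = 0 ∧ a ^ 4 + b ^ 4 + (c ^ 4 + d ^ 4) = 0 then (1 : ℂ) else 0) =
      -- The 9 is the excess of the count `8 (q - 1) + 1` at `a = 0` over the generic `8q - 16`.
      (if a = 0 then 9 else 0) + (8 * Fintype.card F - 16) := by
    intro a
    by_cases ha : a = 0
    · subst ha
      rw [sum_quadric_quartic_zero hz, if_pos rfl]; ring
    · rw [sum_quadric_quartic_of_ne_zero hz ha, if_neg ha]; ring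
  simp only [h, Finset.sum_add_distrib, Finset.sum_ite_eq', Finset.mem_univ, if_true,
    Finset.sum_const, Finset.card_univ, nsmul_eq_mul]
  ring

/-- The coordinates `x ± i y` on the plane, where `i = z ^ 2`. -/
def isotropicEquiv (z : F) (hz : z ^ 4 = -1) : F × F ≃ F × F where
  toFun p := (p.1 + z ^ 2 * p.2, p.1 - z ^ 2 * p.2)
  -- Here `1 / 2 = -1` in characteristic 3, and `1 / z ^ 2 = -z ^ 2`.
  invFun p := (-(p.1 + p.2), z ^ 2 * (p.1 - p.2))
  left_inv p := by
    ext
    · linear_combination (-p.1) * three_eq_zero F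
    · linear_combination (-p.2) * three_eq_zero F + 2 * p.2 * hz
  right_inv p := by
    ext
    · linear_combination (-p.1) * three_eq_zero F + (p.1 - p.2) * hz
    · linear_combination (-p.2) * three_eq_zero F - (p.1 - p.2) * hz

/-- With `i = z ^ 2`, the quadric `x² + y²` factors as `(x + iy)(x - iy)`. The quartic keeps its
diagonal shape up to sign, because the cross term of `(x + iy)⁴ + (x - iy)⁴` is divisible by 3. -/
lemma add_powTriple_eq_zero_iff {z : F} (hz : z ^ 4 = -1) (p : (F × F) × (F × F)) :
    powTriple p.1.1 + powTriple p.1.2 + (powTriple p.2.1 + powTriple p.2.2) = 0 ↔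
      (isotropicEquiv z hz p.1).1 * (isotropicEquiv z hz p.1).2 +
        (isotropicEquiv z hz p.2).1 * (isotropicEquiv z hz p.2).2 = 0 ∧
      (isotropicEquiv z hz p.1).1 ^ 4 + (isotropicEquiv z hz p.1).2 ^ 4 +
        ((isotropicEquiv z hz p.2).1 ^ 4 + (isotropicEquiv z hz p.2).2 ^ 4) = 0 := by
  obtain ⟨⟨x, y⟩, u, v⟩ := p
  have e2 : (x + z ^ 2 * y) * (x - z ^ 2 * y) + (u + z ^ 2 * v) * (u - z ^ 2 * v) =
      x ^ 2 + y ^ 2 + (u ^ 2 + v ^ 2) := by linear_combination (-y ^ 2 - v ^ 2) * hz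
  have e4 : (x + z ^ 2 * y) ^ 4 + (x - z ^ 2 * y) ^ 4 +
      ((u + z ^ 2 * v) ^ 4 + (u - z ^ 2 * v) ^ 4) = -(x ^ 4 + y ^ 4 + (u ^ 4 + v ^ 4)) := by
    linear_combination (x ^ 4 + y ^ 4 + (u ^ 4 + v ^ 4)) * three_eq_zero F +
      4 * z ^ 4 * (x ^ 2 * y ^ 2 + u ^ 2 * v ^ 2) * three_eq_zero F +
      2 * (z ^ 4 - 1) * (y ^ 4 + v ^ 4) * hz
  simp only [isotropicEquiv, Equiv.coe_fn_mk, e2, e4, powTriple, Prod.ext_iff, Prod.fst_add,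
    Prod.snd_add, Prod.fst_zero, Prod.snd_zero, neg_eq_zero]
  constructor
  · rintro ⟨h1, h2, -⟩
    exact ⟨h1, h2⟩
  · rintro ⟨h1, h2⟩
    refine ⟨h1, h2, ?_⟩
    have := sum_pow_five_eq_zero h1 (by linear_combination h2)
    linear_combination this

lemma card_powTriple_four [DecidableEq F] {z : F} (hz : z ^ 4 = -1) :
    ((Finset.univ.filter fun p : (F × F) × (F × F) =>
      powTriple p.1.1 + powTriple p.1.2 + (powTriple p.2.1 + powTriple p.2.2) = 0).card : ℂ) =
      8 * (Fintype.card F - 1) ^ 2 + 1 := by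
  have h := Equiv.sum_comp ((isotropicEquiv z hz).prodCongr (isotropicEquiv z hz))
    (fun p => if p.1.1 * p.1.2 + p.2.1 * p.2.2 = 0 ∧
      p.1.1 ^ 4 + p.1.2 ^ 4 + (p.2.1 ^ 4 + p.2.2 ^ 4) = 0 then (1 : ℂ) else 0)
  rw [Finset.natCast_card_filter, ← sum_quadric_quartic hz]
  simp only [add_powTriple_eq_zero_iff hz]
  refine h.trans ?_
  simp only [Fintype.sum_prod_type]

/-! ### The other counts -/

lemma card_powTriple_one [DecidableEq F] :
    (Finset.univ.filter fun x : F => powTriple x = 0).card = 1 := by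
  rw [Finset.card_eq_one]
  refine ⟨0, ?_⟩
  ext x
  simp [powTriple, Prod.ext_iff]

lemma card_powTriple_two [DecidableEq F] :
    (Finset.univ.filter fun p : F × F => powTriple p.1 + powTriple p.2 = 0).card = 1 := by
  rw [Finset.card_eq_one]
  refine ⟨0, ?_⟩
  ext ⟨x, y⟩
  simp only [powTriple, Prod.ext_iff, Prod.fst_add, Prod.snd_add, Prod.fst_zero, Prod.snd_zero,
    Finset.mem_filter, Finset.mem_univ, true_and, Finset.mem_singleton]
  constructor
  · rintro ⟨h1, h2, -⟩
    have hx : x ^ 4 = 0 := by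
      linear_combination x ^ 4 * three_eq_zero F + (x ^ 2 - y ^ 2) * -h1 - h2
    have hx0 := (pow_eq_zero_iff four_ne_zero).1 hx
    subst hx0
    exact ⟨rfl, by simpa using h1⟩
  · rintro ⟨rfl, rfl⟩
    simp

lemma three_powTriple_iff (p : (F × F) × F) :
    powTriple p.1.1 + powTriple p.1.2 + powTriple p.2 = 0 ↔
      p.1.2 ^ 2 = p.1.1 ^ 2 ∧ p.2 ^ 2 = p.1.1 ^ 2 := by
  obtain ⟨⟨x, y⟩, z⟩ := p
  simp only [powTriple, Prod.ext_iff, Prod.fst_add, Prod.snd_add, Prod.fst_zero, Prod.snd_zero]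
  constructor
  · rintro ⟨h1, h2, -⟩
    exact eq_of_sum_eq_zero_of_sum_sq_eq_zero h1 (by linear_combination h2)
  · rintro ⟨h1, h2⟩
    have h (n : ℕ) : x ^ (2 * n) + y ^ (2 * n) + z ^ (2 * n) = 0 := by
      rw [pow_mul, pow_mul, pow_mul, h1, h2]
      linear_combination (x ^ 2) ^ n * three_eq_zero F
    exact ⟨h 1, h 2, h 5⟩

lemma card_powTriple_three [DecidableEq F] :
    ((Finset.univ.filter fun p : (F × F) × F =>
      powTriple p.1.1 + powTriple p.1.2 + powTriple p.2 = 0).card : ℂ) =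
      4 * (Fintype.card F - 1) + 1 := by
  rw [Finset.natCast_card_filter]
  simp only [three_powTriple_iff, Fintype.sum_prod_type]
  have h : ∀ x : F, ∑ y : F, ∑ z : F, (if y ^ 2 = x ^ 2 ∧ z ^ 2 = x ^ 2 then (1 : ℂ) else 0) =
      if x = 0 then 1 else 4 := by
    intro x
    have h1 : ∀ y z : F, (if y ^ 2 = x ^ 2 ∧ z ^ 2 = x ^ 2 then (1 : ℂ) else 0) =
        (if y ^ 2 = x ^ 2 then 1 else 0) * (if z ^ 2 = x ^ 2 then 1 else 0) := by
      intro y z; split_ifs <;> simp_all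
    simp only [h1, ← Finset.mul_sum, ← Finset.sum_mul, sum_ite_sq_eq]
    split_ifs <;> norm_num
  simp only [h, sum_ite_zero_const]
  ring

lemma card_powTriple_one_one [DecidableEq F] :
    ((Finset.univ.filter fun p : F × F => powTriple p.1 + -powTriple p.2 = 0).card : ℂ) =
      2 * (Fintype.card F - 1) + 1 := by
  rw [Finset.natCast_card_filter]
  have h : ∀ x y : F, powTriple x + -powTriple y = 0 ↔ y ^ 2 = x ^ 2 := by
    intro x y
    simp only [powTriple, Prod.ext_iff, Prod.fst_add, Prod.snd_add, Prod.fst_zero, Prod.snd_zero,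
      Prod.fst_neg, Prod.snd_neg]
    constructor
    · rintro ⟨h1, -, -⟩
      linear_combination -h1
    · intro h1
      have h (n : ℕ) : x ^ (2 * n) + -y ^ (2 * n) = 0 := by
        rw [pow_mul, pow_mul, h1]; ring
      exact ⟨h 1, h 2, h 5⟩
  simp only [Fintype.sum_prod_type, h, sum_ite_sq_eq, sum_ite_zero_const]
  ring

lemma three_one_powTriple_iff {x y z w : F} (hw : w ≠ 0) :
    powTriple x + powTriple y + (powTriple z + -powTriple w) = 0 ↔
      (x ^ 2 = w ^ 2 ∧ y = 0 ∧ z = 0) ∨ (x = 0 ∧ y ^ 2 = w ^ 2 ∧ z = 0) ∨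
        (x = 0 ∧ y = 0 ∧ z ^ 2 = w ^ 2) := by
  simp only [powTriple, Prod.ext_iff, Prod.fst_add, Prod.snd_add, Prod.fst_zero, Prod.snd_zero,
      Prod.fst_neg, Prod.snd_neg]
  have h2 : ∀ v : F, v ^ 2 = 0 ↔ v = 0 := fun v => pow_eq_zero_iff two_ne_zero
  constructor
  · rintro ⟨h1, h2', h5⟩
    have := two_eq_zero_of_power_sums (u := x ^ 2) (v := y ^ 2) (w := z ^ 2) (t := w ^ 2)
      (by linear_combination h1) (by linear_combination h2') (by linear_combination h5)
      (pow_ne_zero 2 hw)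
    simpa only [h2] using this
  · have h4 : ∀ v : F, v ^ 2 = w ^ 2 → v ^ 4 = w ^ 4 := fun v hv => by
      linear_combination (v ^ 2 + w ^ 2) * hv
    have h10 : ∀ v : F, v ^ 2 = w ^ 2 → v ^ 10 = w ^ 10 := fun v hv => by
      rw [show v ^ 10 = (v ^ 2) ^ 5 by ring, hv]; ring
    rintro (⟨h, rfl, rfl⟩ | ⟨rfl, h, rfl⟩ | ⟨rfl, rfl, h⟩) <;> simp [h, h4 _ h, h10 _ h]

lemma card_powTriple_three_one [DecidableEq F] :
    ((Finset.univ.filter fun p : (F × F) × (F × F) =>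
      powTriple p.1.1 + powTriple p.1.2 + (powTriple p.2.1 + -powTriple p.2.2) = 0).card : ℂ) =
      10 * (Fintype.card F - 1) + 1 := by
  rw [Finset.natCast_card_filter]
  have h1 : ∑ p : (F × F) × (F × F),
      (if powTriple p.1.1 + powTriple p.1.2 + (powTriple p.2.1 + -powTriple p.2.2) = 0
        then (1 : ℂ) else 0) = ∑ w : F, ∑ x : F, ∑ y : F, ∑ z : F,
      (if powTriple x + powTriple y + (powTriple z + -powTriple w) = 0 then (1 : ℂ) else 0) := by
    simp only [Fintype.sum_prod_type]
    symm
    rw [Finset.sum_comm]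
    refine Finset.sum_congr rfl fun x _ => ?_
    rw [Finset.sum_comm]
    refine Finset.sum_congr rfl fun y _ => ?_
    rw [Finset.sum_comm]
  have h2 : ∀ w : F, ∑ x : F, ∑ y : F, ∑ z : F,
      (if powTriple x + powTriple y + (powTriple z + -powTriple w) = 0 then (1 : ℂ) else 0) =
      -- For `w ≠ 0` there are three places for the nonzero variable and two signs; `w = 0` gives
      -- the three-variable count `4 (q - 1) + 1`.
      (if w = 0 then 4 * ((Fintype.card F : ℂ) - 1) - 5 else 0) + 6 := by
    intro w
    split_ifs with hw
    · subst hw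
      have h0 : powTriple (0 : F) = 0 := by simp [powTriple]
      have := card_powTriple_three (F := F)
      rw [Finset.natCast_card_filter] at this
      simp only [Fintype.sum_prod_type] at this
      simp only [h0, neg_zero, add_zero, this]
      ring
    · have h3 : ∀ x y z : F,
          (if powTriple x + powTriple y + (powTriple z + -powTriple w) = 0 then (1 : ℂ) else 0) =
          (if x ^ 2 = w ^ 2 then 1 else 0) * (if y = 0 then 1 else 0) * (if z = 0 then 1 else 0) +
          (if x = 0 then 1 else 0) * (if y ^ 2 = w ^ 2 then 1 else 0) * (if z = 0 then 1 else 0) +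
          (if x = 0 then 1 else 0) * (if y = 0 then 1 else 0) *
            (if z ^ 2 = w ^ 2 then 1 else 0) := by
        intro x y z
        have hw2 : ¬ 0 = w ^ 2 := (pow_ne_zero 2 hw).symm
        rw [if_congr (three_one_powTriple_iff hw) rfl rfl]
        by_cases hx : x = 0 <;> by_cases hy : y = 0 <;> by_cases hz : z = 0 <;>
          simp [hx, hy, hz, hw2]
      simp only [h3, Finset.sum_add_distrib, ← Finset.mul_sum, ← Finset.sum_mul, sum_ite_sq_eq,
        Finset.sum_ite_eq', Finset.mem_univ, if_true, if_neg hw]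
      norm_num
  rw [h1, Finset.sum_congr rfl fun w _ => h2 w]
  simp only [Finset.sum_add_distrib, Finset.sum_ite_eq', Finset.mem_univ, if_true,
    Finset.sum_const, Finset.card_univ, nsmul_eq_mul]
  ring

/-! ### Moments of the exponential sum -/

lemma sum_charSum_one : ∑ t : F × F × F, charSum powTriple t = (Fintype.card F : ℂ) ^ 3 := by
  classical
  rw [sum_charSum, card_powTriple_one]; simp

lemma sum_charSum_pow_two :
    ∑ t : F × F × F, charSum powTriple t ^ 2 = (Fintype.card F : ℂ) ^ 3 := by
  classical
  simp only [pow_two (charSum _ _), charSum_mul]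
  rw [sum_charSum, card_powTriple_two]; simp

lemma sum_charSum_pow_three :
    ∑ t : F × F × F, charSum powTriple t ^ 3 =
      (Fintype.card F : ℂ) ^ 3 * (4 * (Fintype.card F - 1) + 1) := by
  classical
  have h : ∀ t : F × F × F, charSum powTriple t ^ 3 =
      charSum powTriple t * charSum powTriple t * charSum powTriple t := fun t => by ring
  simp only [h, charSum_mul]
  rw [sum_charSum, card_powTriple_three]

lemma sum_charSum_pow_four {z : F} (hz : z ^ 4 = -1) :
    ∑ t : F × F × F, charSum powTriple t ^ 4 =
      (Fintype.card F : ℂ) ^ 3 * (8 * (Fintype.card F - 1) ^ 2 + 1) := by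
  classical
  have h : ∀ t : F × F × F, charSum powTriple t ^ 4 =
      charSum powTriple t * charSum powTriple t * (charSum powTriple t * charSum powTriple t) :=
    fun t => by ring
  simp only [h, charSum_mul]
  rw [sum_charSum, card_powTriple_four hz]

lemma sum_charSum_mul_conj :
    ∑ t : F × F × F, charSum powTriple t * conj (charSum powTriple t) =
      (Fintype.card F : ℂ) ^ 3 * (2 * (Fintype.card F - 1) + 1) := by
  classical
  simp only [conj_charSum, charSum_mul]
  rw [sum_charSum, card_powTriple_one_one]

lemma sum_charSum_pow_three_mul_conj :
    ∑ t : F × F × F, charSum powTriple t ^ 3 * conj (charSum powTriple t) =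
      (Fintype.card F : ℂ) ^ 3 * (10 * (Fintype.card F - 1) + 1) := by
  classical
  have h : ∀ t : F × F × F, charSum powTriple t ^ 3 * conj (charSum powTriple t) =
      charSum powTriple t * charSum powTriple t *
        (charSum powTriple t * conj (charSum powTriple t)) := fun t => by ring
  simp only [h]
  simp only [conj_charSum, charSum_mul]
  rw [sum_charSum, card_powTriple_three_one]

lemma charSum_sub_one [DecidableEq F] (t : F × F × F) :
    charSum powTriple t - 1 = charSum (fun x : {x : F // x ≠ 0} => powTriple x.1) t := by
  simp only [charSum]
  rw [← Finset.sum_subtype (Finset.univ.erase (0 : F)) (by simp)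
    (fun x => traceChar F (t.1 * (powTriple x).1 + t.2.1 * (powTriple x).2.1 +
      t.2.2 * (powTriple x).2.2)), ← Finset.add_sum_erase _ _ (Finset.mem_univ (0 : F))]
  simp [powTriple]

/-- Subtracting 1 removes `x = 0`, and the system has no solution in five nonzero variables.
Expanding the fifth power then reduces the fifth moment to the lower ones. -/
lemma sum_charSum_sub_one_pow_five : ∑ t : F × F × F, (charSum powTriple t - 1) ^ 5 = 0 := by
  classical
  have h : ∀ t : F × F × F, (charSum powTriple t - 1) ^ 5 =
      (charSum powTriple t - 1) * (charSum powTriple t - 1) * (charSum powTriple t - 1) *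
       (charSum powTriple t - 1) * (charSum powTriple t - 1) := fun t => by ring
  simp only [h]
  simp only [charSum_sub_one, charSum_mul]
  rw [sum_charSum]
  apply mul_eq_zero_of_right
  rw [Nat.cast_eq_zero, Finset.card_eq_zero, Finset.filter_eq_empty_iff]
  rintro ⟨⟨⟨⟨⟨x, hx⟩, y, hy⟩, z, hz⟩, u, hu⟩, v, hv⟩ - h
  simp only [powTriple, Prod.ext_iff, Prod.fst_add, Prod.snd_add, Prod.fst_zero,
    Prod.snd_zero] at h
  obtain ⟨h1, h2, h5⟩ := h
  have := prod_eq_zero_of_power_sums h1 (by linear_combination h2) (by linear_combination h5)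
  simp_all

lemma sum_charSum_pow_five {z : F} (hz : z ^ 4 = -1) :
    ∑ t : F × F × F, charSum powTriple t ^ 5 =
      (Fintype.card F : ℂ) ^ 3 * (40 * (Fintype.card F - 1) * (Fintype.card F - 2) + 1) := by
  have h : ∀ t : F × F × F, charSum powTriple t ^ 5 = (charSum powTriple t - 1) ^ 5 +
      5 * charSum powTriple t ^ 4 - 10 * charSum powTriple t ^ 3 + 10 * charSum powTriple t ^ 2 -
      5 * charSum powTriple t + 1 := fun t => by ring
  simp only [h, Finset.sum_add_distrib, Finset.sum_sub_distrib, ← Finset.mul_sum,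
    sum_charSum_sub_one_pow_five, sum_charSum_pow_four hz, sum_charSum_pow_three,
    sum_charSum_pow_two, sum_charSum_one, Finset.sum_const, Finset.card_univ, Fintype.card_prod,
    nsmul_eq_mul]
  push_cast; ring

end Counting

/-! ### The code as the set of trace words, and weights in terms of the exponential sum. -/

section Code

variable {F : Type*} [Field F] [Fintype F] [Algebra (ZMod 3) F]

lemma isConjRoot_pow_three_pow (s : F) (k : ℕ) : IsConjRoot (ZMod 3) s (s ^ 3 ^ k) := by
  induction k with
  | zero => simpa using IsConjRoot.refl
  | succ k ih =>
    refine ih.trans ?_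
    have h := isConjRoot_of_algEquiv (R := ZMod 3) (s ^ 3 ^ k)
      (FiniteField.frobeniusAlgEquivOfAlgebraic (ZMod 3) F)
    simpa [FiniteField.frobeniusAlgEquivOfAlgebraic, ZMod.card, ← pow_mul, ← pow_succ] using h

lemma IsConjRoot.sum_eq_zero {n : ℕ} {s z : F} (h : IsConjRoot (ZMod 3) s z)
    (c : Fin n → ZMod 3) (hs : ∑ i : Fin n, algebraMap (ZMod 3) F (c i) * s ^ (i : ℕ) = 0) :
    ∑ i : Fin n, algebraMap (ZMod 3) F (c i) * z ^ (i : ℕ) = 0 := by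
  set P : Polynomial (ZMod 3) := ∑ i : Fin n, .C (c i) * .X ^ (i : ℕ) with hP
  have e : ∀ w : F, Polynomial.aeval w P =
      ∑ i : Fin n, algebraMap (ZMod 3) F (c i) * w ^ (i : ℕ) := by
    intro w; simp [hP]
  rw [← e] at hs ⊢
  have hd := minpoly.dvd (ZMod 3) s hs
  rw [h] at hd
  obtain ⟨R, hR⟩ := hd
  rw [hR, map_mul, minpoly.aeval, zero_mul]

variable (π : F) (l : ℕ)

/-- The word `i ↦ Tr (f (π ^ i))`, where `f` is the polynomial with the coefficients `t`. -/
noncomputable def traceWord (t : F × F × F) (i : Fin l) : ZMod 3 :=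
  Algebra.trace (ZMod 3) F (codePoly t (π ^ (i : ℕ)))

lemma codePoly_sub_left (t u : F × F × F) (x : F) :
    codePoly (t - u) x = codePoly t x - codePoly u x := by
  simp only [codePoly, Prod.fst_sub, Prod.snd_sub]; ring

lemma traceWord_sub (t u : F × F × F) :
    traceWord π l (t - u) = traceWord π l t - traceWord π l u := by
  ext i
  simp only [traceWord, codePoly_sub_left, map_sub, Pi.sub_apply]

/-- The three nonzeros of the code. -/
def codeNonzeros : Set F := {π ^ (-2 : ℤ), π ^ (-(3 + 1) : ℤ), π ^ (-(3 ^ 2 + 1) : ℤ)}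

variable {π l}

lemma eq_zero_of_forall_sum_eq_zero (hπ : IsPrimitiveRoot π l) (c : Fin l → ZMod 3)
    (h : ∀ z : F, z ^ l = 1 → ∑ i : Fin l, algebraMap (ZMod 3) F (c i) * z ^ (i : ℕ) = 0) :
    c = 0 := by
  set P : Polynomial F := ∑ i : Fin l, .C (algebraMap (ZMod 3) F (c i)) * .X ^ (i : ℕ) with hP
  have hP0 : P = 0 := by
    refine Polynomial.eq_zero_of_degree_lt_of_eval_index_eq_zero (s := Finset.range l)
      (v := fun i => π ^ i) ?_ ?_ ?_
    · intro i hi j hj hij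
      exact hπ.pow_inj (by simpa using hi) (by simpa using hj) hij
    · rw [Finset.card_range, hP]
      exact Polynomial.degree_sum_fin_lt _
    · intro i _
      have := h (π ^ i) (by rw [← pow_mul, mul_comm, pow_mul, hπ.pow_eq_one, one_pow])
      simpa [hP, Polynomial.eval_finsetSum] using this
  ext i
  have h1 := congrArg (fun p => p.coeff (i : ℕ)) hP0
  simp only [hP, Polynomial.finsetSum_coeff, Polynomial.coeff_C_mul, Polynomial.coeff_X_pow,
    Polynomial.coeff_zero, Fin.val_inj, mul_ite, mul_one, mul_zero, Finset.sum_ite_eq,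
    Finset.mem_univ, if_true] at h1
  exact (map_eq_zero _).1 h1

/-- A geometric sum over an `l`-th root of unity. Its ratio is 1 only if `z` is a Frobenius
conjugate of `π ^ (-e)`. -/
lemma sum_pow_mul_pow_eq_zero (hπ : IsPrimitiveRoot π l) {z : F} (hz : z ^ l = 1) (e k : ℕ)
    (h : ¬ IsConjRoot (ZMod 3) (π ^ (-e : ℤ)) z) :
    ∑ i : Fin l, ((π ^ (i : ℕ)) ^ e) ^ 3 ^ k * z ^ (i : ℕ) = 0 := by
  set w := (π ^ e) ^ 3 ^ k * z with hw
  have h1 : ∑ i : Fin l, ((π ^ (i : ℕ)) ^ e) ^ 3 ^ k * z ^ (i : ℕ) = ∑ i ∈ Finset.range l, w ^ i := by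
    rw [Finset.sum_range]
    refine Finset.sum_congr rfl fun i _ => ?_
    rw [hw]; ring
  have hw1 : w ≠ 1 := by
    intro hw1
    apply h
    have : z = (π ^ (-e : ℤ)) ^ 3 ^ k := by
      rw [zpow_neg, zpow_natCast, inv_pow]
      exact eq_inv_of_mul_eq_one_right hw1
    rw [this]
    exact isConjRoot_pow_three_pow _ _
  have hwl : w ^ l = 1 := by
    have : ((π ^ e) ^ 3 ^ k) ^ l = (π ^ l) ^ (e * 3 ^ k) := by
      rw [← pow_mul, ← pow_mul, ← pow_mul]; congr 1; ring
    rw [hw, mul_pow, hz, mul_one, this, hπ.pow_eq_one, one_pow]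
  rw [h1, geom_sum_eq hw1, hwl, sub_self, zero_div]

lemma traceWord_mem (hπ : IsPrimitiveRoot π l) (t : F × F × F) :
    traceWord π l t ∈ cyclicCode (ZMod 3) l (codeNonzeros π) := by
  intro z hz hS
  have hS1 := hS _ (Or.inl rfl)
  have hS2 := hS _ (Or.inr (Or.inl rfl))
  have hS3 := hS _ (Or.inr (Or.inr rfl))
  have := charP_three F
  have h1 : ∀ i : Fin l, algebraMap (ZMod 3) F (traceWord π l t i) * z ^ (i : ℕ) =
      ∑ k ∈ Finset.range (Module.finrank (ZMod 3) F),
        (t.1 ^ 3 ^ k * (((π ^ (i : ℕ)) ^ 2) ^ 3 ^ k * z ^ (i : ℕ)) +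
          t.2.1 ^ 3 ^ k * (((π ^ (i : ℕ)) ^ 4) ^ 3 ^ k * z ^ (i : ℕ)) +
          t.2.2 ^ 3 ^ k * (((π ^ (i : ℕ)) ^ 10) ^ 3 ^ k * z ^ (i : ℕ))) := by
    intro i
    rw [traceWord, FiniteField.algebraMap_trace_eq_sum_pow, Finset.sum_mul]
    refine Finset.sum_congr rfl fun k _ => ?_
    rw [Nat.card_eq_fintype_card, ZMod.card, codePoly, add_pow_char_pow, add_pow_char_pow]
    ring
  simp only [h1]
  rw [Finset.sum_comm]
  refine Finset.sum_eq_zero fun k _ => ?_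
  rw [Finset.sum_add_distrib, Finset.sum_add_distrib, ← Finset.mul_sum, ← Finset.mul_sum,
    ← Finset.mul_sum, sum_pow_mul_pow_eq_zero hπ hz 2 k hS1,
    sum_pow_mul_pow_eq_zero hπ hz 4 k hS2, sum_pow_mul_pow_eq_zero hπ hz 10 k hS3]
  simp

/-- A codeword is determined by its values at the three nonzeros: if these vanish, so do the values
at all conjugates, and a polynomial of degree less than `l` vanishing at all `l`-th roots of unity
is zero. -/
lemma ncard_cyclicCode_le (hπ : IsPrimitiveRoot π l) :
    (cyclicCode (ZMod 3) l (codeNonzeros π) : Set (Fin l → ZMod 3)).ncard ≤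
      (Set.univ : Set (F × F × F)).ncard := by
  let φ (c : Fin l → ZMod 3) (z : F) : F := ∑ i : Fin l, algebraMap (ZMod 3) F (c i) * z ^ (i : ℕ)
  have hφ : ∀ c d z, φ (c - d) z = φ c z - φ d z := by
    intro c d z
    simp only [φ, Pi.sub_apply, map_sub, sub_mul, Finset.sum_sub_distrib]
  refine Set.ncard_le_ncard_of_injOn (fun c => (φ c (π ^ (-2 : ℤ)), φ c (π ^ (-(3 + 1) : ℤ)),
    φ c (π ^ (-(3 ^ 2 + 1) : ℤ)))) (fun _ _ => Set.mem_univ _) ?_ Set.finite_univ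
  intro c hc d hd hcd
  simp only [Prod.mk.injEq, ← sub_eq_zero (a := φ c _), ← hφ] at hcd
  rw [← sub_eq_zero]
  refine eq_zero_of_forall_sum_eq_zero hπ _ fun z hz => ?_
  by_cases h : ∀ s ∈ codeNonzeros π, ¬ IsConjRoot (ZMod 3) s z
  · exact (sub_mem hc hd : c - d ∈ cyclicCode (ZMod 3) l (codeNonzeros π)) z hz h
  · push Not at h
    obtain ⟨s, hs, hsz⟩ := h
    refine hsz.sum_eq_zero _ ?_
    rcases hs with rfl | rfl | rfl
    · exact hcd.1
    · exact hcd.2.1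
    · exact hcd.2.2

lemma card_filter_trace_ne_zero (t : F × F × F) :
    (Finset.univ.filter fun x : F => Algebra.trace (ZMod 3) F (codePoly t x) ≠ 0).card =
      valueCount t 1 + valueCount t 2 := by
  have h := Finset.card_filter_add_card_filter_not (s := (Finset.univ : Finset F))
    (fun x : F => Algebra.trace (ZMod 3) F (codePoly t x) = 0)
  rw [Finset.card_univ, ← sum_valueCount t] at h
  change valueCount t 0 + _ = _ at h
  simp only [ne_eq]
  omega

variable {m : ℕ}

lemma hammingNorm_traceWord (hF : Fintype.card F = 3 ^ m) (hπ : IsPrimitiveRoot π (3 ^ m - 1))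
    (hm : m ≠ 0) (t : F × F × F) :
    hammingNorm (traceWord π (3 ^ m - 1) t) = valueCount t 1 + valueCount t 2 := by
  classical
  have hl : 3 ^ m - 1 ≠ 0 := by
    have : 1 < 3 ^ m := Nat.one_lt_pow hm (by norm_num)
    omega
  have : NeZero (3 ^ m - 1) := ⟨hl⟩
  rw [← card_filter_trace_ne_zero, hammingNorm]
  refine Finset.card_bij (fun i _ => π ^ (i : ℕ)) ?_ ?_ ?_
  · intro i hi
    exact Finset.mem_filter.2 ⟨Finset.mem_univ _, (Finset.mem_filter.1 hi).2⟩
  · intro i _ j _ hij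
    exact Fin.ext (hπ.pow_inj i.2 j.2 hij)
  -- The word runs over the nonzero elements only, which loses nothing because the form vanishes at
  -- 0.
  · intro x hx
    have hx0 : x ≠ 0 := by
      rintro rfl
      simp [codePoly] at hx
    have hxl : x ^ (3 ^ m - 1) = 1 := by rw [← hF]; exact FiniteField.pow_card_sub_one_eq_one x hx0
    obtain ⟨i, hi, rfl⟩ := hπ.eq_pow_of_pow_eq_one hxl
    exact ⟨⟨i, hi⟩, Finset.mem_filter.2 ⟨Finset.mem_univ _, (Finset.mem_filter.1 hx).2⟩, rfl⟩

/-- The weight of a word of the code in terms of its exponential sum. -/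
lemma three_mul_hammingNorm (hF : Fintype.card F = 3 ^ m) (hπ : IsPrimitiveRoot π (3 ^ m - 1))
    (hm : m ≠ 0) (t : F × F × F) :
    (3 * hammingNorm (traceWord π (3 ^ m - 1) t) : ℝ) =
      2 * (3 ^ m - (charSum powTriple t).re) := by
  have h := sum_valueCount t
  rw [hF] at h
  have h' : (valueCount t 0 + valueCount t 1 + valueCount t 2 : ℝ) = 3 ^ m := by exact_mod_cast h
  rw [hammingNorm_traceWord hF hπ hm, re_charSum, ← h']
  push_cast; ring

/-- The modulus is at most `√3 ^ (m + 4)`, which is below `√3 ^ (2 * m)`. It follows that nonzero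
triples give words of positive weight. -/
lemma re_charSum_lt (hF : Fintype.card F = 3 ^ m) (hm : 4 < m) {t : F × F × F} (ht : t ≠ 0) :
    (charSum powTriple t).re < 3 ^ m := by
  obtain ⟨j, hj, h⟩ := charSum_eq_pow hF ht
  have hn : ‖charSum powTriple t‖ = √3 ^ (m + j) := by
    have : ‖(Complex.I * (√3 : ℝ)) ^ (m + j)‖ = √3 ^ (m + j) := by
      rw [norm_pow, norm_mul, Complex.norm_I, one_mul, Complex.norm_real, Real.norm_eq_abs,
        abs_of_nonneg (Real.sqrt_nonneg 3)]
    rcases h with h | h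
    · rw [h, this]
    · rw [h, norm_neg, this]
  refine (Complex.re_le_norm _).trans_lt ?_
  have h3 : (3 : ℝ) ^ m = √3 ^ (2 * m) := by rw [pow_mul, Real.sq_sqrt (by norm_num)]
  rw [hn, h3]
  exact pow_lt_pow_right₀ (by rw [Real.lt_sqrt] <;> norm_num) (by omega)

lemma traceWord_injective (hF : Fintype.card F = 3 ^ m) (hπ : IsPrimitiveRoot π (3 ^ m - 1))
    (hm : 4 < m) : Function.Injective (traceWord π (3 ^ m - 1)) := by
  intro t u htu
  by_contra hne
  have h0 : t - u ≠ 0 := sub_ne_zero.2 hne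
  have h1 := three_mul_hammingNorm hF hπ (by omega) (t - u)
  rw [traceWord_sub, htu, sub_self, hammingNorm_zero] at h1
  have h2 := re_charSum_lt hF hm h0
  push_cast at h1
  linarith

/-- The trace words lie in the code, are `q ^ 3` in number by injectivity, and the code has at most
`q ^ 3` words. -/
lemma cyclicCode_eq_range (hF : Fintype.card F = 3 ^ m) (hπ : IsPrimitiveRoot π (3 ^ m - 1))
    (hm : 4 < m) : (cyclicCode (ZMod 3) (3 ^ m - 1) (codeNonzeros π) : Set _) =
      Set.range (traceWord π (3 ^ m - 1)) := by
  symm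
  apply Set.eq_of_subset_of_ncard_le
  · rintro _ ⟨t, rfl⟩
    exact traceWord_mem hπ t
  · rw [← Set.image_univ, Set.ncard_image_of_injective _ (traceWord_injective hF hπ hm)]
    exact ncard_cyclicCode_le hπ
  · exact Set.toFinite _

end Code

/-! ### The ten values of the exponential sum and their multiplicities. -/

section Distribution

/-- The value `ε p ^ ((m + j) / 2)` or `ε i p ^ ((m + j) / 2)`. -/
noncomputable def sumValue (m : ℕ) (i : ℤ × ℕ) : ℂ :=
  (i.1 : ℂ) * (if Even i.2 then 1 else Complex.I) * ((Real.sqrt 3 : ℝ) : ℂ) ^ (m + i.2)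

/-- The pairs `(ε, j)` that label the values of the exponential sum. -/
def signRange : Finset (ℤ × ℕ) := {1, -1} ×ˢ Finset.range 5

lemma mem_signRange {i : ℤ × ℕ} : i ∈ signRange ↔ (i.1 = 1 ∨ i.1 = -1) ∧ i.2 < 5 := by
  simp [signRange]

lemma sqrt_three_ne_zero : ((√3 : ℝ) : ℂ) ≠ 0 := by
  rw [Complex.ofReal_ne_zero]; positivity

lemma norm_sumValue (m : ℕ) {i : ℤ × ℕ} (hi : i ∈ signRange) :
    ‖sumValue m i‖ = √3 ^ (m + i.2) := by
  have h1 : ‖(i.1 : ℂ)‖ = 1 := by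
    rcases (mem_signRange.1 hi).1 with h | h <;> simp [h]
  have h2 : ‖(if Even i.2 then 1 else Complex.I : ℂ)‖ = 1 := by split_ifs <;> simp
  rw [sumValue, norm_mul, norm_mul, h1, h2, norm_pow, Complex.norm_real, Real.norm_eq_abs,
    abs_of_nonneg (Real.sqrt_nonneg 3), one_mul, one_mul]

lemma one_lt_sqrt_three : 1 < √3 := by
  rw [Real.lt_sqrt] <;> norm_num

lemma sumValue_injOn (m : ℕ) : Set.InjOn (sumValue m) signRange := by
  rintro ⟨e, j⟩ hi ⟨e', j'⟩ hi' h
  have h1 := congrArg norm h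
  rw [norm_sumValue m hi, norm_sumValue m hi'] at h1
  have h2 := pow_right_injective₀ (by positivity) one_lt_sqrt_three.ne' h1
  obtain rfl : j = j' := by simpa using h2
  have h3 : (if Even j then 1 else Complex.I : ℂ) ≠ 0 := by split_ifs <;> simp
  have h4 := mul_right_cancel₀ h3 (mul_right_cancel₀ (pow_ne_zero _ sqrt_three_ne_zero) h)
  simp only [Int.cast_inj] at h4
  rw [h4]

variable {F : Type*} [Field F] [Fintype F] [Algebra (ZMod 3) F] {m : ℕ}

lemma mem_expSumSet {t : F × F × F} {ε : ℤ} {j : ℕ} :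
    t ∈ expSumSet F m ε j ↔ t ≠ 0 ∧ charSum powTriple t = sumValue m (ε, j) := Iff.rfl

lemma exists_charSum_eq_sumValue (hF : Fintype.card F = 3 ^ m) (hm : Even m) {t : F × F × F}
    (ht : t ≠ 0) : ∃ i ∈ signRange, charSum powTriple t = sumValue m i := by
  obtain ⟨j, hj, h⟩ := charSum_eq_pow hF ht
  obtain ⟨k, rfl⟩ := hm
  have hI : ∃ e : ℤ, (e = 1 ∨ e = -1) ∧ Complex.I ^ (k + k + j) =
      e * (if Even j then 1 else Complex.I) := by
    have h1 : ∀ n : ℕ, Complex.I ^ (n + n) = 1 ∨ Complex.I ^ (n + n) = -1 := by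
      intro n
      rw [← two_mul, pow_mul, Complex.I_sq]
      exact neg_one_pow_eq_or ℂ n
    rcases Nat.even_or_odd j with hj | hj
    · obtain ⟨i, rfl⟩ := hj
      rw [if_pos (by simp), show k + k + (i + i) = (k + i) + (k + i) by ring]
      rcases h1 (k + i) with h | h
      · exact ⟨1, Or.inl rfl, by rw [h]; simp⟩
      · exact ⟨-1, Or.inr rfl, by rw [h]; simp⟩
    · rw [if_neg (by simpa using hj)]
      obtain ⟨i, rfl⟩ := hj
      rw [show k + k + (2 * i + 1) = (k + i) + (k + i) + 1 by ring, pow_succ]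
      rcases h1 (k + i) with h | h
      · exact ⟨1, Or.inl rfl, by rw [h]; simp⟩
      · exact ⟨-1, Or.inr rfl, by rw [h]; simp⟩
  obtain ⟨e, he, hI⟩ := hI
  rw [mul_pow, hI] at h
  rcases h with h | h
  · exact ⟨(e, j), mem_signRange.2 ⟨he, by simp; omega⟩, h⟩
  · refine ⟨(-e, j), mem_signRange.2 ⟨by simp; omega, by simp; omega⟩, ?_⟩
    rw [h, sumValue]; push_cast; ring

lemma expSumCount_eq_card [DecidableEq F] (ε : ℤ) (j : ℕ) : expSumCount F m ε j =
    ((Finset.univ.erase (0 : F × F × F)).filter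
      fun t => charSum powTriple t = sumValue m (ε, j)).card := by
  rw [expSumCount, ← Set.ncard_coe_finset]
  congr 1
  ext t
  simp [mem_expSumSet]

/-- A sum over the values of the exponential sum, in terms of its value distribution. -/
lemma sum_charSum_eq_sum_expSumCount (hF : Fintype.card F = 3 ^ m) (hm : Even m) (g : ℂ → ℂ) :
    ∑ t : F × F × F, g (charSum powTriple t) = g (3 ^ m) +
      ∑ j ∈ Finset.range 5, (expSumCount F m 1 j * g (sumValue m (1, j)) +
        expSumCount F m (-1) j * g (sumValue m (-1, j))) := by
  classical
  rw [← Finset.add_sum_erase _ _ (Finset.mem_univ (0 : F × F × F)), charSum_powTriple_zero, hF]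
  have h1 : ∀ t ∈ Finset.univ.erase (0 : F × F × F), g (charSum powTriple t) =
      ∑ i ∈ signRange, if charSum powTriple t = sumValue m i then g (sumValue m i) else 0 := by
    intro t ht
    obtain ⟨i, hi, h⟩ := exists_charSum_eq_sumValue hF hm (Finset.ne_of_mem_erase ht)
    rw [Finset.sum_eq_single_of_mem i hi, if_pos h, h]
    intro i' hi' hne
    rw [if_neg]
    rw [h]
    exact fun h' => hne (sumValue_injOn m hi hi' h').symm
  rw [Finset.sum_congr rfl h1, Finset.sum_comm]
  have h2 : ∀ i : ℤ × ℕ, ∑ t ∈ Finset.univ.erase (0 : F × F × F),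
      (if charSum powTriple t = sumValue m i then g (sumValue m i) else 0) =
      expSumCount F m i.1 i.2 * g (sumValue m i) := by
    intro i
    rw [← Finset.sum_filter, Finset.sum_const, nsmul_eq_mul, expSumCount_eq_card]
  rw [Finset.sum_congr rfl fun i _ => h2 i, signRange, Finset.sum_product, Finset.sum_pair (by decide),
    Finset.sum_add_distrib]
  push_cast; rfl

/-- Complex conjugation exchanges the two imaginary values. -/
lemma expSumCount_neg_of_odd {j : ℕ} (hj : ¬ Even j) :
    expSumCount F m 1 j = expSumCount F m (-1) j := by
  have h : expSumSet F m (-1) j = Neg.neg '' expSumSet F m 1 j := by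
    ext t
    simp only [Set.image_neg_eq_neg, Set.mem_neg, mem_expSumSet, neg_ne_zero, charSum_neg]
    refine and_congr_right fun _ => ?_
    rw [← (starRingEnd ℂ).injective.eq_iff (b := sumValue m (1, j)), Complex.conj_conj]
    simp only [sumValue, if_neg hj, map_mul, map_pow, Complex.conj_I, Complex.conj_ofReal]
    simp
  rw [expSumCount, expSumCount, h, Set.ncard_image_of_injective _ neg_injective]

/-- An element with fourth power `-1`. -/
lemma exists_pow_four_eq_neg_one (hF : Fintype.card F = 3 ^ m) (hm : Even m) (hm0 : m ≠ 0) :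
    ∃ z : F, z ^ 4 = -1 := by
  classical
  obtain ⟨k, rfl⟩ := hm
  obtain ⟨g, hg⟩ := IsCyclic.exists_ofOrder_eq_natCard (α := Fˣ)
  have hc : Nat.card Fˣ = 9 ^ k - 1 := by
    rw [Nat.card_eq_fintype_card, Fintype.card_units, hF, ← two_mul, pow_mul]; norm_num
  have h8 : 8 ∣ 9 ^ k - 1 := by simpa using Nat.sub_dvd_pow_sub_pow 9 1 k
  obtain ⟨d, hd⟩ := h8
  have hpos : 0 < d := by
    have : 1 < 9 ^ k := Nat.one_lt_pow (by omega) (by norm_num)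
    omega
  refine ⟨((g ^ d : Fˣ) : F), ?_⟩
  -- The generator has order `8 d`, so the fourth power of `g ^ d` is a square root of 1 other than
  -- 1.
  have h1 : ((g ^ (d * 4) : Fˣ) : F) ^ 2 = 1 := by
    rw [← Units.val_pow_eq_pow_val, ← pow_mul, show d * 4 * 2 = Nat.card Fˣ by rw [hc, hd]; ring,
      ← hg, pow_orderOf_eq_one, Units.val_one]
  rw [← Units.val_pow_eq_pow_val, ← pow_mul]
  refine (sq_eq_one_iff.1 h1).resolve_left fun h2 => ?_
  have h3 := orderOf_dvd_of_pow_eq_one (Units.ext h2 : g ^ (d * 4) = 1)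
  rw [hg, hc, hd] at h3
  have := Nat.le_of_dvd (by omega) h3
  omega

end Distribution

/-! ### Linear equations for the multiplicities, one from each moment. -/

section LinearSystem

lemma sumValue_two_mul (k : ℕ) (ε : ℤ) :
    sumValue (2 * k) (ε, 0) = ε * 3 ^ k ∧
    sumValue (2 * k) (ε, 1) = ε * (Complex.I * (√3 : ℝ)) * 3 ^ k ∧
    sumValue (2 * k) (ε, 2) = ε * 3 * 3 ^ k ∧
    sumValue (2 * k) (ε, 3) = ε * (Complex.I * (√3 : ℝ)) * 3 * 3 ^ k ∧
    sumValue (2 * k) (ε, 4) = ε * 9 * 3 ^ k := by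
  have h := sqrt_three_sq
  have h0 : ∀ j, ((√3 : ℝ) : ℂ) ^ (2 * k + j) = 3 ^ k * ((√3 : ℝ) : ℂ) ^ j := by
    intro j; rw [pow_add, pow_mul, h]
  have h3 : ((√3 : ℝ) : ℂ) ^ 3 = 3 * (√3 : ℝ) := by rw [pow_succ, h]
  have h4 : ((√3 : ℝ) : ℂ) ^ 4 = 9 := by
    rw [show (4 : ℕ) = 2 * 2 by rfl, pow_mul, h]; norm_num
  have e2 : Even 2 := by decide
  have e3 : ¬ Even 3 := by decide
  have e4 : Even 4 := by decide
  simp only [sumValue, h0, h, h3, h4, e2, e3, e4, if_true, if_false, Nat.not_even_one, Even.zero,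
    pow_zero, pow_one]
  refine ⟨?_, ?_, ?_, ?_, ?_⟩ <;> ring

variable {F : Type*} [Field F] [Fintype F] [Algebra (ZMod 3) F] {k : ℕ}

variable (F) in
/-- The sum of the numbers of the two triples with the values `±p ^ ((m + j) / 2)`. -/
noncomputable def countAdd (m j : ℕ) : ℚ := expSumCount F m 1 j + expSumCount F m (-1) j

variable (F) in
/-- The difference of the numbers of the two triples with the values `±p ^ ((m + j) / 2)`. -/
noncomputable def countSub (m j : ℕ) : ℚ := expSumCount F m 1 j - expSumCount F m (-1) j

lemma sum_range_five (f : ℕ → ℂ) :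
    ∑ j ∈ Finset.range 5, f j = f 0 + f 1 + f 2 + f 3 + f 4 := by
  simp [Finset.sum_range_succ]

lemma lam_sq : (Complex.I * (√3 : ℝ)) ^ 2 = -3 := by
  rw [mul_pow, sqrt_three_sq, Complex.I_sq]; ring

lemma lam_pow_four : (Complex.I * (√3 : ℝ)) ^ 4 = 9 := by
  linear_combination (Complex.I ^ 2 * (√3 : ℝ) ^ 2 - 3) * lam_sq

/-- An even moment of the exponential sum. -/
lemma sum_of_even (hF : Fintype.card F = 3 ^ (2 * k)) (g : ℂ → ℂ) (hg : ∀ z, g (-z) = g z) :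
    ∑ t : F × F × F, g (charSum powTriple t) = g (3 ^ (2 * k)) +
      (countAdd F (2 * k) 0 * g (3 ^ k) +
        2 * expSumCount F (2 * k) 1 1 * g (Complex.I * (√3 : ℝ) * 3 ^ k) +
        countAdd F (2 * k) 2 * g (3 * 3 ^ k) +
        2 * expSumCount F (2 * k) 1 3 * g (Complex.I * (√3 : ℝ) * 3 * 3 ^ k) +
        countAdd F (2 * k) 4 * g (9 * 3 ^ k)) := by
  rw [sum_charSum_eq_sum_expSumCount hF (even_two_mul k) g, sum_range_five]
  obtain ⟨h0, h1, h2, h3, h4⟩ := sumValue_two_mul k 1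
  obtain ⟨h0', h1', h2', h3', h4'⟩ := sumValue_two_mul k (-1)
  have e1 := expSumCount_neg_of_odd (F := F) (m := 2 * k) (j := 1) (by decide)
  have e3 := expSumCount_neg_of_odd (F := F) (m := 2 * k) (j := 3) (by decide)
  rw [h0, h1, h2, h3, h4, h0', h1', h2', h3', h4', ← e1, ← e3]
  simp only [Int.cast_one, one_mul, Int.cast_neg, neg_mul, hg, countAdd]
  push_cast; ring

/-- An odd moment of the exponential sum. -/
lemma sum_of_odd (hF : Fintype.card F = 3 ^ (2 * k)) (g : ℂ → ℂ) (hg : ∀ z, g (-z) = -g z) :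
    ∑ t : F × F × F, g (charSum powTriple t) = g (3 ^ (2 * k)) +
      (countSub F (2 * k) 0 * g (3 ^ k) + countSub F (2 * k) 2 * g (3 * 3 ^ k) +
        countSub F (2 * k) 4 * g (9 * 3 ^ k)) := by
  rw [sum_charSum_eq_sum_expSumCount hF (even_two_mul k) g, sum_range_five]
  obtain ⟨h0, h1, h2, h3, h4⟩ := sumValue_two_mul k 1
  obtain ⟨h0', h1', h2', h3', h4'⟩ := sumValue_two_mul k (-1)
  have e1 := expSumCount_neg_of_odd (F := F) (m := 2 * k) (j := 1) (by decide)
  have e3 := expSumCount_neg_of_odd (F := F) (m := 2 * k) (j := 3) (by decide)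
  rw [h0, h1, h2, h3, h4, h0', h1', h2', h3', h4', ← e1, ← e3]
  simp only [Int.cast_one, one_mul, Int.cast_neg, neg_mul, hg, countSub]
  push_cast; ring

lemma card_eq_three_pow_sq (hF : Fintype.card F = 3 ^ (2 * k)) :
    (Fintype.card F : ℂ) = (3 ^ k) ^ 2 := by
  rw [hF]; push_cast; rw [← pow_mul, mul_comm]

lemma moment_zero (hF : Fintype.card F = 3 ^ (2 * k)) :
    countAdd F (2 * k) 0 + 2 * expSumCount F (2 * k) 1 1 + countAdd F (2 * k) 2 +
      2 * expSumCount F (2 * k) 1 3 + countAdd F (2 * k) 4 = (3 ^ k) ^ 6 - 1 := by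
  have h := sum_of_even hF (fun _ => 1) (fun _ => rfl)
  rw [Finset.sum_const, Finset.card_univ, Fintype.card_prod, Fintype.card_prod, nsmul_eq_mul] at h
  push_cast at h
  rw [card_eq_three_pow_sq hF] at h
  have h' : ((countAdd F (2 * k) 0 + 2 * expSumCount F (2 * k) 1 1 + countAdd F (2 * k) 2 +
      2 * expSumCount F (2 * k) 1 3 + countAdd F (2 * k) 4 : ℚ) : ℂ) =
      (((3 ^ k) ^ 6 - 1 : ℚ) : ℂ) := by
    push_cast
    linear_combination -h
  exact_mod_cast h'

/-- In this and the other moment identities, the moment of degree `n` is divided by `(3 ^ k) ^ n`,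
and the contribution of `t = 0`, where the sum equals `q`, is moved to the right. -/
lemma moment_two (hF : Fintype.card F = 3 ^ (2 * k)) :
    countAdd F (2 * k) 0 - 3 * (2 * expSumCount F (2 * k) 1 1) + 9 * countAdd F (2 * k) 2 -
      27 * (2 * expSumCount F (2 * k) 1 3) + 81 * countAdd F (2 * k) 4 =
      (3 ^ k) ^ 4 - (3 ^ k) ^ 2 := by
  have h := sum_of_even hF (fun z => z ^ 2) (fun z => by ring)
  rw [sum_charSum_pow_two, card_eq_three_pow_sq hF, pow_mul' (3 : ℂ) 2 k] at h
  have hT : (3 ^ k : ℂ) ^ 2 ≠ 0 := by simp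
  have h' : ((countAdd F (2 * k) 0 - 3 * (2 * expSumCount F (2 * k) 1 1) +
      9 * countAdd F (2 * k) 2 - 27 * (2 * expSumCount F (2 * k) 1 3) +
      81 * countAdd F (2 * k) 4 : ℚ) : ℂ) = (((3 ^ k) ^ 4 - (3 ^ k) ^ 2 : ℚ) : ℂ) := by
    push_cast
    apply mul_left_cancel₀ hT
    linear_combination -h - (3 ^ k : ℂ) ^ 2 * (2 * expSumCount F (2 * k) 1 1 +
      9 * (2 * expSumCount F (2 * k) 1 3)) * lam_sq
  exact_mod_cast h'

lemma moment_four (hF : Fintype.card F = 3 ^ (2 * k)) (hk : k ≠ 0) :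
    countAdd F (2 * k) 0 + 9 * (2 * expSumCount F (2 * k) 1 1) + 81 * countAdd F (2 * k) 2 +
      729 * (2 * expSumCount F (2 * k) 1 3) + 6561 * countAdd F (2 * k) 4 =
      (3 ^ k) ^ 2 * (8 * ((3 ^ k) ^ 2 - 1) ^ 2 + 1) - (3 ^ k) ^ 4 := by
  obtain ⟨z, hz⟩ := exists_pow_four_eq_neg_one hF (even_two_mul k) (by omega)
  have h := sum_of_even hF (fun z => z ^ 4) (fun z => by ring)
  rw [sum_charSum_pow_four hz, card_eq_three_pow_sq hF, pow_mul' (3 : ℂ) 2 k] at h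
  have hT : (3 ^ k : ℂ) ^ 4 ≠ 0 := by simp
  have h' : ((countAdd F (2 * k) 0 + 9 * (2 * expSumCount F (2 * k) 1 1) +
      81 * countAdd F (2 * k) 2 + 729 * (2 * expSumCount F (2 * k) 1 3) +
      6561 * countAdd F (2 * k) 4 : ℚ) : ℂ) =
      (((3 ^ k) ^ 2 * (8 * ((3 ^ k) ^ 2 - 1) ^ 2 + 1) - (3 ^ k) ^ 4 : ℚ) : ℂ) := by
    push_cast
    apply mul_left_cancel₀ hT
    linear_combination -h - (3 ^ k : ℂ) ^ 4 * (2 * expSumCount F (2 * k) 1 1 +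
      81 * (2 * expSumCount F (2 * k) 1 3)) * lam_pow_four
  exact_mod_cast h'

/-- Compared with `moment_two`, only the terms of the imaginary values change sign, so half the sum
and half the difference isolate the two kinds of values. `moment_three_one` does the same for
`moment_four`. -/
lemma moment_one_one (hF : Fintype.card F = 3 ^ (2 * k)) :
    countAdd F (2 * k) 0 + 3 * (2 * expSumCount F (2 * k) 1 1) + 9 * countAdd F (2 * k) 2 +
      27 * (2 * expSumCount F (2 * k) 1 3) + 81 * countAdd F (2 * k) 4 =
      (3 ^ k) ^ 4 * (2 * ((3 ^ k) ^ 2 - 1) + 1) - (3 ^ k) ^ 2 := by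
  have h := sum_of_even hF (fun z => z * conj z) (fun z => by simp)
  rw [sum_charSum_mul_conj, card_eq_three_pow_sq hF, pow_mul' (3 : ℂ) 2 k] at h
  simp only [map_mul, map_pow, map_ofNat, Complex.conj_I, Complex.conj_ofReal] at h
  have hT : (3 ^ k : ℂ) ^ 2 ≠ 0 := by simp
  have h' : ((countAdd F (2 * k) 0 + 3 * (2 * expSumCount F (2 * k) 1 1) +
      9 * countAdd F (2 * k) 2 + 27 * (2 * expSumCount F (2 * k) 1 3) +
      81 * countAdd F (2 * k) 4 : ℚ) : ℂ) =
      (((3 ^ k) ^ 4 * (2 * ((3 ^ k) ^ 2 - 1) + 1) - (3 ^ k) ^ 2 : ℚ) : ℂ) := by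
    push_cast
    apply mul_left_cancel₀ hT
    linear_combination -h + (3 ^ k : ℂ) ^ 2 * (2 * expSumCount F (2 * k) 1 1 +
      9 * (2 * expSumCount F (2 * k) 1 3)) * lam_sq
  exact_mod_cast h'

lemma moment_three_one (hF : Fintype.card F = 3 ^ (2 * k)) :
    countAdd F (2 * k) 0 - 9 * (2 * expSumCount F (2 * k) 1 1) + 81 * countAdd F (2 * k) 2 -
      729 * (2 * expSumCount F (2 * k) 1 3) + 6561 * countAdd F (2 * k) 4 =
      (3 ^ k) ^ 2 * (10 * ((3 ^ k) ^ 2 - 1) + 1) - (3 ^ k) ^ 4 := by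
  have h := sum_of_even hF (fun z => z ^ 3 * conj z) (fun z => by simp only [map_neg]; ring)
  rw [sum_charSum_pow_three_mul_conj, card_eq_three_pow_sq hF, pow_mul' (3 : ℂ) 2 k] at h
  simp only [map_mul, map_pow, map_ofNat, Complex.conj_I, Complex.conj_ofReal] at h
  have hT : (3 ^ k : ℂ) ^ 4 ≠ 0 := by simp
  have h' : ((countAdd F (2 * k) 0 - 9 * (2 * expSumCount F (2 * k) 1 1) +
      81 * countAdd F (2 * k) 2 - 729 * (2 * expSumCount F (2 * k) 1 3) +
      6561 * countAdd F (2 * k) 4 : ℚ) : ℂ) =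
      (((3 ^ k) ^ 2 * (10 * ((3 ^ k) ^ 2 - 1) + 1) - (3 ^ k) ^ 4 : ℚ) : ℂ) := by
    push_cast
    apply mul_left_cancel₀ hT
    linear_combination -h + (3 ^ k : ℂ) ^ 4 * (2 * expSumCount F (2 * k) 1 1 +
      81 * (2 * expSumCount F (2 * k) 1 3)) * lam_pow_four
  exact_mod_cast h'

lemma moment_one (hF : Fintype.card F = 3 ^ (2 * k)) :
    countSub F (2 * k) 0 + 3 * countSub F (2 * k) 2 + 9 * countSub F (2 * k) 4 =
      (3 ^ k) ^ 5 - 3 ^ k := by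
  have h := sum_of_odd hF (fun z => z) (fun z => by ring)
  rw [sum_charSum_one, card_eq_three_pow_sq hF, pow_mul' (3 : ℂ) 2 k] at h
  have hT : (3 ^ k : ℂ) ≠ 0 := by simp
  have h' : ((countSub F (2 * k) 0 + 3 * countSub F (2 * k) 2 + 9 * countSub F (2 * k) 4 : ℚ) : ℂ) =
      (((3 ^ k) ^ 5 - 3 ^ k : ℚ) : ℂ) := by
    push_cast
    apply mul_left_cancel₀ hT
    linear_combination -h
  exact_mod_cast h'

lemma moment_three (hF : Fintype.card F = 3 ^ (2 * k)) :
    countSub F (2 * k) 0 + 27 * countSub F (2 * k) 2 + 729 * countSub F (2 * k) 4 =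
      (3 ^ k) ^ 3 * (4 * ((3 ^ k) ^ 2 - 1) + 1) - (3 ^ k) ^ 3 := by
  have h := sum_of_odd hF (fun z => z ^ 3) (fun z => by ring)
  rw [sum_charSum_pow_three, card_eq_three_pow_sq hF, pow_mul' (3 : ℂ) 2 k] at h
  have hT : (3 ^ k : ℂ) ^ 3 ≠ 0 := by simp
  have h' : ((countSub F (2 * k) 0 + 27 * countSub F (2 * k) 2 +
      729 * countSub F (2 * k) 4 : ℚ) : ℂ) =
      (((3 ^ k) ^ 3 * (4 * ((3 ^ k) ^ 2 - 1) + 1) - (3 ^ k) ^ 3 : ℚ) : ℂ) := by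
    push_cast
    apply mul_left_cancel₀ hT
    linear_combination -h
  exact_mod_cast h'

lemma moment_five (hF : Fintype.card F = 3 ^ (2 * k)) (hk : k ≠ 0) :
    countSub F (2 * k) 0 + 243 * countSub F (2 * k) 2 + 59049 * countSub F (2 * k) 4 =
      3 ^ k * (40 * ((3 ^ k) ^ 2 - 1) * ((3 ^ k) ^ 2 - 2) + 1) - (3 ^ k) ^ 5 := by
  obtain ⟨z, hz⟩ := exists_pow_four_eq_neg_one hF (even_two_mul k) (by omega)
  have h := sum_of_odd hF (fun z => z ^ 5) (fun z => by ring)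
  rw [sum_charSum_pow_five hz, card_eq_three_pow_sq hF, pow_mul' (3 : ℂ) 2 k] at h
  have hT : (3 ^ k : ℂ) ^ 5 ≠ 0 := by simp
  have h' : ((countSub F (2 * k) 0 + 243 * countSub F (2 * k) 2 +
      59049 * countSub F (2 * k) 4 : ℚ) : ℂ) =
      ((3 ^ k * (40 * ((3 ^ k) ^ 2 - 1) * ((3 ^ k) ^ 2 - 2) + 1) - (3 ^ k) ^ 5 : ℚ) : ℂ) := by
    push_cast
    apply mul_left_cancel₀ hT
    linear_combination -h
  exact_mod_cast h'

end LinearSystem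

/-! ### Solving the linear system, and positivity of the multiplicities. -/

section Explicit

/-! ### The constants as polynomials in `3 ^ (m / 2)` -/

/-- The constant is half the sum of the right sides of `moment_two` and `moment_one_one`, that is,
the normalised sum of `(Re S) ^ 2` over `t ≠ 0`. -/
lemma explicit_a_eq {k : ℕ} (hk : k ≠ 0) :
    Explicit.a 3 (2 * k) = (3 ^ k : ℚ) ^ 6 - (3 ^ k) ^ 2 := by
  obtain ⟨n, rfl⟩ := Nat.exists_eq_succ_of_ne_zero hk
  have hT : (3 ^ n : ℚ) ≠ 0 := by positivity
  simp only [Explicit.a, Explicit.dualA2, Nat.succ_eq_add_one,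
    show 3 * (2 * (n + 1)) - 2 = n * 6 + 4 by omega,
    show 2 * (2 * (n + 1) - 1) = n * 4 + 2 by omega,
    show 3 * (2 * (n + 1)) - 1 = n * 6 + 5 by omega, show 2 * (n + 1) - 2 = n * 2 by omega]
  simp only [show 3 * (2 * (n + 1)) = n * 6 + 6 by omega,
    show 2 * (2 * (n + 1)) = n * 4 + 4 by omega]
  simp only [show 2 * (n + 1) = n * 2 + 2 by omega, pow_add, pow_mul]
  generalize (3 ^ n : ℚ) = T at *
  field_simp
  ring

/-- Half the sum of the right sides of `moment_four` and `moment_three_one`: the normalised sum of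
`(Re S) ^ 4` over `t ≠ 0`. -/
lemma explicit_b_eq {k : ℕ} (hk : 2 ≤ k) :
    Explicit.b 3 (2 * k) = ((3 ^ k : ℚ) ^ 2 * (8 * ((3 ^ k) ^ 2 - 1) ^ 2 + 1) +
      (3 ^ k) ^ 2 * (10 * ((3 ^ k) ^ 2 - 1) + 1)) / 2 - (3 ^ k) ^ 4 := by
  rw [Explicit.b, explicit_a_eq (by omega)]
  obtain ⟨n, rfl⟩ := Nat.exists_eq_add_of_le hk
  have hT : (3 ^ n : ℚ) ≠ 0 := by positivity
  -- The truncated subtractions are rewritten as honest exponents in `n`, so that everything becomes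
  -- a rational function of `3 ^ n`.
  simp only [Explicit.dualA2, Explicit.dualA4,
    show 3 * (2 * (2 + n)) - 4 = n * 6 + 8 by omega,
    show 3 * (2 * (2 + n)) - 1 = n * 6 + 11 by omega,
    show 3 * (2 * (2 + n) - 1) = n * 6 + 9 by omega,
    show 4 * (2 * (2 + n) - 1) = n * 8 + 12 by omega,
    show 2 * (2 * (2 + n) - 1) = n * 4 + 6 by omega,
    show 2 * (2 * (2 + n)) - 4 = n * 4 + 4 by omega, show 2 * (2 + n) - 2 = n * 2 + 2 by omega]
  simp only [show 2 * (2 * (2 + n)) + 1 = n * 4 + 9 by omega]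
  simp only [show 3 * (2 * (2 + n)) = n * 6 + 12 by omega,
    show 2 * (2 * (2 + n)) = n * 4 + 8 by omega]
  simp only [show 2 * (2 + n) = n * 2 + 4 by omega]
  simp only [show 2 + n = n + 2 by omega, pow_add, pow_mul]
  generalize (3 ^ n : ℚ) = T at *
  field_simp
  ring

/-- In order, the right sides of `moment_zero`, `moment_one`, `moment_two`, `moment_three`,
`moment_four` and `moment_five`. -/
lemma explicit_c_eq (k : ℕ) :
    Explicit.c1 3 (2 * k) = (3 ^ k : ℚ) ^ 6 - 1 ∧
    Explicit.c2 3 (2 * k) = (3 ^ k : ℚ) ^ 5 - 3 ^ k ∧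
    Explicit.c3 3 (2 * k) = (3 ^ k : ℚ) ^ 4 - (3 ^ k) ^ 2 ∧
    Explicit.c4 3 (2 * k) = 4 * ((3 ^ k : ℚ) ^ 5 - (3 ^ k) ^ 3) ∧
    Explicit.c5 3 (2 * k) =
      (3 ^ k : ℚ) ^ 2 * (8 * ((3 ^ k) ^ 2 - 1) ^ 2 + 1) - (3 ^ k) ^ 4 ∧
    Explicit.c6 3 (2 * k) =
      3 ^ k * (40 * ((3 ^ k : ℚ) ^ 2 - 1) * ((3 ^ k) ^ 2 - 2) + 1) - (3 ^ k) ^ 5 := by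
  simp only [Explicit.c1, Explicit.c2, Explicit.c3, Explicit.c4, Explicit.c5, Explicit.c6,
    show 2 * k / 2 = k by omega, show 3 * (2 * k) / 2 = k * 3 by omega]
  simp only [show 3 * (2 * k) = k * 6 by omega, show 2 * (2 * k) = k * 4 by omega]
  simp only [show 2 * k = k * 2 by omega, pow_mul, true_and]
  refine ⟨?_, ?_, ?_, ?_, ?_⟩ <;> ring

variable {F : Type*} [Field F] [Fintype F] [Algebra (ZMod 3) F] {k : ℕ}

lemma two_mul_expSumCount_one (hF : Fintype.card F = 3 ^ (2 * k)) (hk : 2 ≤ k) :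
    2 * (expSumCount F (2 * k) 1 1 : ℚ) = Explicit.twoN1 3 (2 * k) := by
  obtain ⟨h1, h2, h3, h4, h5, h6⟩ := explicit_c_eq k
  rw [Explicit.twoN1, explicit_a_eq (by omega), explicit_b_eq hk, h3, h5]
  have e2 := moment_two hF
  have e4 := moment_four hF (by omega)
  have e11 := moment_one_one hF
  have e31 := moment_three_one hF
  generalize (3 ^ k : ℚ) = T at *
  rw [eq_div_iff (by norm_num)]
  linarith

lemma two_mul_expSumCount_three (hF : Fintype.card F = 3 ^ (2 * k)) (hk : 2 ≤ k) :
    2 * (expSumCount F (2 * k) 1 3 : ℚ) = Explicit.twoN3 3 (2 * k) := by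
  obtain ⟨h1, h2, h3, h4, h5, h6⟩ := explicit_c_eq k
  rw [Explicit.twoN3, explicit_a_eq (by omega), explicit_b_eq hk, h3, h5]
  have e2 := moment_two hF
  have e4 := moment_four hF (by omega)
  have e11 := moment_one_one hF
  have e31 := moment_three_one hF
  generalize (3 ^ k : ℚ) = T at *
  rw [eq_div_iff (by norm_num)]
  linarith

lemma expSumCount_eq (m j : ℕ) {ε : ℤ} (hε : ε = 1 ∨ ε = -1) :
    (expSumCount F m ε j : ℚ) = (countAdd F m j + ε * countSub F m j) / 2 := by
  rcases hε with rfl | rfl <;> simp only [countAdd, countSub] <;> push_cast <;> ring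

lemma expSumCount_eq_explicit (hF : Fintype.card F = 3 ^ (2 * k)) (hk : 2 ≤ k) {ε : ℤ}
    (hε : ε = 1 ∨ ε = -1) :
    (expSumCount F (2 * k) ε 0 : ℚ) = Explicit.n0 3 (2 * k) ε ∧
    (expSumCount F (2 * k) ε 2 : ℚ) = Explicit.n2 3 (2 * k) ε ∧
    (expSumCount F (2 * k) ε 4 : ℚ) = Explicit.n4 3 (2 * k) ε := by
  obtain ⟨h1, h2, h3, h4, h5, h6⟩ := explicit_c_eq k
  rw [Explicit.n0, Explicit.n2, Explicit.n4, explicit_a_eq (by omega), explicit_b_eq hk, h1, h2, h3,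
    h4, h5, h6, expSumCount_eq _ _ hε, expSumCount_eq _ _ hε, expSumCount_eq _ _ hε]
  have e0 := moment_zero hF
  have e1 := moment_one hF
  have e2 := moment_two hF
  have e3 := moment_three hF
  have e4 := moment_four hF (by omega)
  have e5 := moment_five hF (by omega)
  have e11 := moment_one_one hF
  have e31 := moment_three_one hF
  generalize (3 ^ k : ℚ) = T at *
  rcases hε with rfl | rfl
  · push_cast
    -- The equations are linear in the multiplicities with numerical coefficients; the powers of `T`
    -- enter only as constants.
    refine ⟨?_, ?_, ?_⟩ <;> rw [eq_div_iff (by norm_num)] <;> linarith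
  · push_cast
    refine ⟨?_, ?_, ?_⟩ <;> rw [eq_div_iff (by norm_num)] <;> linarith

lemma expSumCount_pos (hF : Fintype.card F = 3 ^ (2 * k)) (hk : 3 ≤ k) {ε : ℤ}
    (hε : ε = 1 ∨ ε = -1) {j : ℕ} (hj : j = 0 ∨ j = 2 ∨ j = 4) :
    0 < expSumCount F (2 * k) ε j := by
  obtain ⟨h0, h2, h4⟩ := expSumCount_eq_explicit hF (by omega) hε
  obtain ⟨g1, g2, g3, g4, g5, g6⟩ := explicit_c_eq k
  rw [Explicit.n0, explicit_a_eq (by omega), explicit_b_eq (by omega), g1, g2, g3, g4, g5, g6] at h0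
  rw [Explicit.n2, explicit_a_eq (by omega), g1, g2, g3, g4, g5, g6] at h2
  rw [Explicit.n4, explicit_a_eq (by omega), explicit_b_eq (by omega), g1, g2, g3, g4, g5, g6] at h4
  have hT : (27 : ℚ) ≤ 3 ^ k := by
    calc (27 : ℚ) = 3 ^ 3 := by norm_num
      _ ≤ 3 ^ k := pow_le_pow_right₀ (by norm_num) hk
  -- Shifting by `27 = 3 ^ 3`, the least value of `3 ^ k`, leaves polynomials in `x ≥ 0` whose
  -- positivity is visible from their coefficients.
  obtain ⟨x, hx0, hx⟩ : ∃ x : ℚ, 0 ≤ x ∧ (3 ^ k : ℚ) = x + 27 := ⟨3 ^ k - 27, by linarith, by ring⟩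
  rw [hx] at h0 h2 h4
  suffices h : (0 : ℚ) < expSumCount F (2 * k) ε j by exact_mod_cast h
  rcases hj with rfl | rfl | rfl
  · rw [h0]; rcases hε with rfl | rfl <;> push_cast <;> ring_nf <;> positivity
  · rw [h2]; rcases hε with rfl | rfl <;> push_cast <;> ring_nf <;> positivity
  · rw [h4]; rcases hε with rfl | rfl <;> push_cast <;> ring_nf <;> positivity

lemma expSumCount_one_pos (hF : Fintype.card F = 3 ^ (2 * k)) (hk : 3 ≤ k) :
    0 < expSumCount F (2 * k) 1 1 := by
  have h := two_mul_expSumCount_one hF (by omega)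
  obtain ⟨g1, g2, g3, g4, g5, g6⟩ := explicit_c_eq k
  rw [Explicit.twoN1, explicit_a_eq (by omega), explicit_b_eq (by omega), g3, g5] at h
  have hT : (27 : ℚ) ≤ 3 ^ k := by
    calc (27 : ℚ) = 3 ^ 3 := by norm_num
      _ ≤ 3 ^ k := pow_le_pow_right₀ (by norm_num) hk
  obtain ⟨x, hx0, hx⟩ : ∃ x : ℚ, 0 ≤ x ∧ (3 ^ k : ℚ) = x + 27 := ⟨3 ^ k - 27, by linarith, by ring⟩
  rw [hx] at h
  have h' : (0 : ℚ) < 2 * expSumCount F (2 * k) 1 1 := by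
    rw [h]; ring_nf; positivity
  exact_mod_cast (pos_of_mul_pos_right h' (by norm_num) : (0 : ℚ) < expSumCount F (2 * k) 1 1)

end Explicit

/-! ### From the value distribution to the weight distribution. -/

section Weights

variable {F : Type*} [Field F] [Fintype F] [Algebra (ZMod 3) F] {π : F} {k : ℕ}

lemma codeWeight_two_mul (k : ℕ) (hk : k ≠ 0) (ε : ℤ) (i : ℕ) :
    codeWeight (2 * k) ε (2 * i) = 2 / 3 * ((3 ^ k) ^ 2 - ε * 3 ^ i * 3 ^ k) := by
  have h : (3 : ℚ) ^ (2 * k) = 3 * 3 ^ (2 * k - 1) := by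
    rw [← pow_succ']; congr 1; omega
  rw [codeWeight, show (2 * k + 2 * i) / 2 = k + i by omega, ← pow_mul, mul_comm k 2, h, pow_add]
  ring

lemma hammingNorm_traceWord_eq_iff (hF : Fintype.card F = 3 ^ (2 * k))
    (hπ : IsPrimitiveRoot π (3 ^ (2 * k) - 1)) (hk : k ≠ 0) (t : F × F × F) (ε : ℤ) (i : ℕ) :
    (hammingNorm (traceWord π (3 ^ (2 * k) - 1) t) : ℚ) = codeWeight (2 * k) ε (2 * i) ↔
      (charSum powTriple t).re = ε * 3 ^ i * 3 ^ k := by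
  have h := three_mul_hammingNorm hF hπ (by omega) t
  rw [codeWeight_two_mul k hk, ← (Rat.cast_injective (α := ℝ)).eq_iff]
  push_cast
  rw [pow_mul' (3 : ℝ) 2 k] at h
  constructor <;> intro h1 <;> rw [h1] at h <;> linarith

lemma sumValue_re (k : ℕ) (ε : ℤ) :
    (sumValue (2 * k) (ε, 0)).re = ε * 3 ^ 0 * 3 ^ k ∧ (sumValue (2 * k) (ε, 1)).re = 0 ∧
    (sumValue (2 * k) (ε, 2)).re = ε * 3 ^ 1 * 3 ^ k ∧ (sumValue (2 * k) (ε, 3)).re = 0 ∧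
    (sumValue (2 * k) (ε, 4)).re = ε * 3 ^ 2 * 3 ^ k := by
  obtain ⟨h0, h1, h2, h3, h4⟩ := sumValue_two_mul k ε
  rw [h0, h1, h2, h3, h4]
  refine ⟨?_, ?_, ?_, ?_, ?_⟩
  · rw [show (ε * 3 ^ k : ℂ) = ((ε * 3 ^ 0 * 3 ^ k : ℝ) : ℂ) by push_cast; ring, Complex.ofReal_re]
  · rw [show (ε * (Complex.I * (√3 : ℝ)) * 3 ^ k : ℂ) = ((ε * √3 * 3 ^ k : ℝ) : ℂ) * Complex.I by
      push_cast; ring, Complex.re_ofReal_mul, Complex.I_re, mul_zero]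
  · rw [show (ε * 3 * 3 ^ k : ℂ) = ((ε * 3 ^ 1 * 3 ^ k : ℝ) : ℂ) by push_cast; ring,
      Complex.ofReal_re]
  · rw [show (ε * (Complex.I * (√3 : ℝ)) * 3 * 3 ^ k : ℂ) =
      ((ε * √3 * 3 * 3 ^ k : ℝ) : ℂ) * Complex.I by push_cast; ring,
      Complex.re_ofReal_mul, Complex.I_re, mul_zero]
  · rw [show (ε * 9 * 3 ^ k : ℂ) = ((ε * 3 ^ 2 * 3 ^ k : ℝ) : ℂ) by push_cast; ring,
      Complex.ofReal_re]

lemma exists_sign_charSum (hF : Fintype.card F = 3 ^ (2 * k)) {t : F × F × F} (ht : t ≠ 0) :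
    ∃ ε ∈ ({1, -1} : Set ℤ), ∃ j < 5, charSum powTriple t = sumValue (2 * k) (ε, j) := by
  obtain ⟨⟨e, j⟩, hi, h⟩ := exists_charSum_eq_sumValue hF (even_two_mul k) ht
  obtain ⟨he, hj⟩ := mem_signRange.1 hi
  exact ⟨e, he, j, hj, h⟩

lemma twenty_seven_le (hk : 3 ≤ k) : (27 : ℝ) ≤ 3 ^ k := by
  calc (27 : ℝ) = 3 ^ 3 := by norm_num
    _ ≤ 3 ^ k := pow_le_pow_right₀ (by norm_num) hk

/-- The zero triple has sum `(3 ^ k) ^ 2 ≥ 27 * 3 ^ k`, beyond the largest value `9 * 3 ^ k` of a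
nonzero one. -/
lemma ne_zero_of_re_charSum_le (hF : Fintype.card F = 3 ^ (2 * k)) (hk : 3 ≤ k) {t : F × F × F}
    (h : (charSum powTriple t).re ≤ 9 * 3 ^ k) : t ≠ 0 := by
  rintro rfl
  rw [charSum_powTriple_zero, hF] at h
  have h1 : (((3 ^ (2 * k) : ℕ) : ℂ)).re = (3 ^ k : ℝ) ^ 2 := by
    rw [Complex.natCast_re]; push_cast; rw [← pow_mul, mul_comm]
  rw [h1] at h
  have := twenty_seven_le hk
  nlinarith

lemma setOf_re_charSum_eq_zero (hF : Fintype.card F = 3 ^ (2 * k)) (hk : 3 ≤ k) :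
    {t : F × F × F | (charSum powTriple t).re = (0 : ℤ) * 3 ^ 0 * 3 ^ k} =
      (expSumSet F (2 * k) 1 1 ∪ expSumSet F (2 * k) (-1) 1) ∪
        (expSumSet F (2 * k) 1 3 ∪ expSumSet F (2 * k) (-1) 3) := by
  have hT := twenty_seven_le hk
  ext t
  simp only [Set.mem_ofPred_eq, Int.cast_zero, zero_mul, Set.mem_union, mem_expSumSet]
  constructor
  · intro h
    have ht : t ≠ 0 := ne_zero_of_re_charSum_le hF hk (by rw [h]; positivity)
    obtain ⟨ε, hε, j, hj, hS⟩ := exists_sign_charSum hF ht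
    obtain ⟨h0, h1, h2, h3, h4⟩ := sumValue_re k ε
    have hε0 : (ε : ℝ) ≠ 0 := by rcases hε with rfl | rfl <;> norm_num
    have hne : ∀ i : ℕ, (ε * 3 ^ i * 3 ^ k : ℝ) ≠ 0 := fun i => by positivity
    rw [hS] at h
    interval_cases j
    · exact absurd (h0.symm.trans h) (hne 0)
    · rcases hε with rfl | rfl <;> tauto
    · exact absurd (h2.symm.trans h) (hne 1)
    · rcases hε with rfl | rfl <;> tauto
    · exact absurd (h4.symm.trans h) (hne 2)
  · rintro ((⟨-, h⟩ | ⟨-, h⟩) | (⟨-, h⟩ | ⟨-, h⟩)) <;> rw [h]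
    · exact (sumValue_re k 1).2.1
    · exact (sumValue_re k (-1)).2.1
    · exact (sumValue_re k 1).2.2.2.1
    · exact (sumValue_re k (-1)).2.2.2.1

/-- Every value is real or purely imaginary, so a nonzero real part is already the whole value. -/
lemma setOf_re_charSum_eq (hF : Fintype.card F = 3 ^ (2 * k)) (hk : 3 ≤ k) {ε : ℤ}
    (hε : ε ∈ ({1, -1} : Set ℤ)) {i : ℕ} (hi : i ≤ 2) :
    {t : F × F × F | (charSum powTriple t).re = ε * 3 ^ i * 3 ^ k} =
      expSumSet F (2 * k) ε (2 * i) := by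
  have hT := twenty_seven_le hk
  have hval : sumValue (2 * k) (ε, 2 * i) = ((ε * 3 ^ i * 3 ^ k : ℝ) : ℂ) := by
    obtain ⟨h0, h1, h2, h3, h4⟩ := sumValue_two_mul k ε
    push_cast
    interval_cases i
    · rw [mul_zero, h0]; ring
    · rw [mul_one, h2]; ring
    · rw [show 2 * 2 = 4 by rfl, h4]; ring
  ext t
  simp only [Set.mem_ofPred_eq, mem_expSumSet]
  constructor
  · intro h
    have ht : t ≠ 0 := by
      apply ne_zero_of_re_charSum_le hF hk
      rw [h]
      gcongr
      have : (3 : ℝ) ^ i ≤ 3 ^ 2 := pow_le_pow_right₀ (by norm_num) hi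
      have h0 : (0 : ℝ) < 3 ^ i := by positivity
      rcases hε with rfl | rfl <;> push_cast <;> linarith
    refine ⟨ht, ?_⟩
    obtain ⟨ε', -, j, hj, hS⟩ := exists_sign_charSum hF ht
    obtain ⟨h0, h1, h2, h3, h4⟩ := sumValue_re k ε'
    obtain ⟨g0, -, g2, -, g4⟩ := sumValue_two_mul k ε'
    have hε0 : (ε : ℝ) ≠ 0 := by rcases hε with rfl | rfl <;> norm_num
    have hne : (ε * 3 ^ i * 3 ^ k : ℝ) ≠ 0 := by positivity
    rw [hval, ← h, hS]
    rw [hS] at h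
    interval_cases j
    · rw [h0, g0]; push_cast; ring
    · exact absurd (h.symm.trans h1) hne
    · rw [h2, g2]; push_cast; ring
    · exact absurd (h.symm.trans h3) hne
    · rw [h4, g4]; push_cast; ring
  · rintro ⟨-, h⟩
    rw [h, hval, Complex.ofReal_re]

lemma disjoint_expSumSet (m : ℕ) {i i' : ℤ × ℕ} (hi : i ∈ signRange) (hi' : i' ∈ signRange)
    (hne : i ≠ i') : Disjoint (expSumSet F m i.1 i.2) (expSumSet F m i'.1 i'.2) := by
  rw [Set.disjoint_left]
  rintro t ⟨-, h⟩ ⟨-, h'⟩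
  exact hne (sumValue_injOn m hi hi' (h.symm.trans h'))

lemma ncard_union_expSumSet (k : ℕ) :
    ((expSumSet F (2 * k) 1 1 ∪ expSumSet F (2 * k) (-1) 1) ∪
        (expSumSet F (2 * k) 1 3 ∪ expSumSet F (2 * k) (-1) 3)).ncard =
      2 * (expSumCount F (2 * k) 1 1 + expSumCount F (2 * k) 1 3) := by
  have hd : ∀ i i' : ℤ × ℕ, i ∈ signRange → i' ∈ signRange → i ≠ i' →
      Disjoint (expSumSet F (2 * k) i.1 i.2) (expSumSet F (2 * k) i'.1 i'.2) :=
    fun i i' => disjoint_expSumSet (2 * k)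
  have e1 := expSumCount_neg_of_odd (F := F) (m := 2 * k) (j := 1) (by decide)
  have e3 := expSumCount_neg_of_odd (F := F) (m := 2 * k) (j := 3) (by decide)
  rw [Set.ncard_union_eq, Set.ncard_union_eq (hd (1, 1) (-1, 1) (by decide) (by decide) (by decide)),
    Set.ncard_union_eq (hd (1, 3) (-1, 3) (by decide) (by decide) (by decide))]
  · simp only [expSumCount] at e1 e3 ⊢
    omega
  · rw [Set.disjoint_union_left, Set.disjoint_union_right, Set.disjoint_union_right]
    exact ⟨⟨hd (1, 1) (1, 3) (by decide) (by decide) (by decide),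
      hd (1, 1) (-1, 3) (by decide) (by decide) (by decide)⟩,
      hd (-1, 1) (1, 3) (by decide) (by decide) (by decide),
      hd (-1, 1) (-1, 3) (by decide) (by decide) (by decide)⟩

lemma weightFreq_eq_ncard (hF : Fintype.card F = 3 ^ (2 * k))
    (hπ : IsPrimitiveRoot π (3 ^ (2 * k) - 1)) (hk : 3 ≤ k) (ε : ℤ) (i : ℕ) :
    weightFreq (cyclicCode (ZMod 3) (3 ^ (2 * k) - 1) (codeNonzeros π))
      (codeWeight (2 * k) ε (2 * i)) =
      {t : F × F × F | (charSum powTriple t).re = ε * 3 ^ i * 3 ^ k}.ncard := by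
  rw [weightFreq, ← Set.ncard_image_of_injective _ (traceWord_injective hF hπ (by omega))]
  congr 1
  ext c
  simp only [Set.mem_ofPred_eq, Set.mem_image, ← hammingNorm_traceWord_eq_iff hF hπ (by omega)]
  rw [← SetLike.mem_coe, cyclicCode_eq_range hF hπ (by omega)]
  constructor
  · rintro ⟨⟨t, rfl⟩, h⟩
    exact ⟨t, h, rfl⟩
  · rintro ⟨t, h, rfl⟩
    exact ⟨⟨t, rfl⟩, h⟩

/-- The weights are an injective affine function of `Re S / 3 ^ k`, which reduces their distinctness
to that of `0, ±1, ±3, ±9`. -/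
lemma codeWeight_set_eq_image (hk : k ≠ 0) :
    ({codeWeight (2 * k) 0 0, codeWeight (2 * k) 1 0, codeWeight (2 * k) (-1) 0,
        codeWeight (2 * k) 1 2, codeWeight (2 * k) (-1) 2,
        codeWeight (2 * k) 1 4, codeWeight (2 * k) (-1) 4} : Set ℚ) =
      (fun x : ℚ => 2 / 3 * ((3 ^ k) ^ 2 - x * 3 ^ k)) '' ({0, 1, -1, 3, -3, 9, -9} : Finset ℚ) := by
  have h0 := fun ε => codeWeight_two_mul k hk ε 0
  have h1 := fun ε => codeWeight_two_mul k hk ε 1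
  have h2 := fun ε => codeWeight_two_mul k hk ε 2
  simp only [Nat.mul_zero, Nat.mul_one, show 2 * 2 = 4 by rfl] at h0 h1 h2
  simp only [h0, h1, h2, Finset.coe_insert, Finset.coe_singleton, Set.image_insert_eq,
    Set.image_singleton]
  norm_num

lemma ncard_codeWeights (hk : k ≠ 0) :
    ({codeWeight (2 * k) 0 0, codeWeight (2 * k) 1 0, codeWeight (2 * k) (-1) 0,
        codeWeight (2 * k) 1 2, codeWeight (2 * k) (-1) 2,
        codeWeight (2 * k) 1 4, codeWeight (2 * k) (-1) 4} : Set ℚ).ncard = 7 := by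
  rw [codeWeight_set_eq_image hk, Set.ncard_image_of_injective, Set.ncard_coe_finset]
  · rfl
  · intro x y hxy
    have hT : (3 ^ k : ℚ) ≠ 0 := by positivity
    apply mul_right_cancel₀ hT
    simp only at hxy
    linarith

/-- The seven weights, labelled by the sign and half of the even index `j`. -/
lemma codeWeight_set_eq (k : ℕ) :
    ({codeWeight (2 * k) 0 0, codeWeight (2 * k) 1 0, codeWeight (2 * k) (-1) 0,
        codeWeight (2 * k) 1 2, codeWeight (2 * k) (-1) 2,
        codeWeight (2 * k) 1 4, codeWeight (2 * k) (-1) 4} : Set ℚ) =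
      {w | ∃ (ε : ℤ) (i : ℕ), (ε = 0 ∧ i = 0 ∨ ε ∈ ({1, -1} : Set ℤ) ∧ i ≤ 2) ∧
        codeWeight (2 * k) ε (2 * i) = w} := by
  ext w
  simp only [Set.mem_insert_iff, Set.mem_singleton_iff, Set.mem_ofPred_eq]
  constructor
  · rintro (rfl | rfl | rfl | rfl | rfl | rfl | rfl)
    exacts [⟨0, 0, by simp, rfl⟩, ⟨1, 0, by simp, rfl⟩, ⟨-1, 0, by simp, rfl⟩, ⟨1, 1, by simp, rfl⟩,
      ⟨-1, 1, by simp, rfl⟩, ⟨1, 2, by simp, rfl⟩, ⟨-1, 2, by simp, rfl⟩]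
  · rintro ⟨ε, i, ⟨rfl, rfl⟩ | ⟨rfl | rfl, hi⟩, rfl⟩
    · exact Or.inl rfl
    all_goals interval_cases i <;> simp

lemma codeWeight_ne_zero (hk : 3 ≤ k) {ε : ℤ} {i : ℕ}
    (h : ε = 0 ∧ i = 0 ∨ ε ∈ ({1, -1} : Set ℤ) ∧ i ≤ 2) : codeWeight (2 * k) ε (2 * i) ≠ 0 := by
  rw [codeWeight_two_mul k (by omega)]
  have hT : (27 : ℚ) ≤ 3 ^ k := by exact_mod_cast twenty_seven_le hk
  have h1 : (ε * 3 ^ i : ℚ) ≤ 9 := by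
    rcases h with ⟨rfl, rfl⟩ | ⟨rfl | rfl, hi⟩
    · norm_num
    all_goals interval_cases i <;> norm_num
  have : (0 : ℚ) < (3 ^ k - ε * 3 ^ i) * 3 ^ k := by
    apply mul_pos <;> linarith
  apply ne_of_gt
  linarith

lemma nonzeroWeights_eq (hF : Fintype.card F = 3 ^ (2 * k))
    (hπ : IsPrimitiveRoot π (3 ^ (2 * k) - 1)) (hk : 3 ≤ k) :
    nonzeroWeights (cyclicCode (ZMod 3) (3 ^ (2 * k) - 1) (codeNonzeros π)) =
      {codeWeight (2 * k) 0 0, codeWeight (2 * k) 1 0, codeWeight (2 * k) (-1) 0,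
        codeWeight (2 * k) 1 2, codeWeight (2 * k) (-1) 2,
        codeWeight (2 * k) 1 4, codeWeight (2 * k) (-1) 4} := by
  rw [codeWeight_set_eq]
  ext w
  simp only [nonzeroWeights, Set.mem_ofPred_eq]
  constructor
  · rintro ⟨hw, c, hc, rfl⟩
    rw [← SetLike.mem_coe, cyclicCode_eq_range hF hπ (by omega)] at hc
    obtain ⟨t, rfl⟩ := hc
    have ht : t ≠ 0 := by
      rintro rfl
      apply hw
      have : traceWord π (3 ^ (2 * k) - 1) 0 = 0 := by
        ext i; simp [traceWord, codePoly]
      rw [this, hammingNorm_zero, Nat.cast_zero]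
    obtain ⟨ε, hε, j, hj, hS⟩ := exists_sign_charSum hF ht
    obtain ⟨h0, h1, h2, h3, h4⟩ := sumValue_re k ε
    simp only [eq_comm (a := codeWeight _ _ _),
      hammingNorm_traceWord_eq_iff hF hπ (show k ≠ 0 by omega)]
    rw [hS]
    interval_cases j
    · exact ⟨ε, 0, Or.inr ⟨hε, by omega⟩, h0⟩
    · exact ⟨0, 0, Or.inl ⟨rfl, rfl⟩, by rw [h1]; simp⟩
    · exact ⟨ε, 1, Or.inr ⟨hε, by omega⟩, h2⟩
    · exact ⟨0, 0, Or.inl ⟨rfl, rfl⟩, by rw [h3]; simp⟩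
    · exact ⟨ε, 2, Or.inr ⟨hε, by omega⟩, h4⟩
  · rintro ⟨ε, i, h, rfl⟩
    refine ⟨codeWeight_ne_zero hk h, ?_⟩
    have hne : {t : F × F × F | (charSum powTriple t).re = ε * 3 ^ i * 3 ^ k}.Nonempty := by
      rcases h with ⟨rfl, rfl⟩ | ⟨hε, hi⟩
      · rw [setOf_re_charSum_eq_zero hF hk]
        -- The middle weight needs only one imaginary level to be attained, and `j = 1` suffices.
        have := Set.nonempty_of_ncard_ne_zero (expSumCount_one_pos hF hk).ne'
        exact (this.mono Set.subset_union_left).mono Set.subset_union_left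
      · rw [setOf_re_charSum_eq hF hk hε hi]
        exact Set.nonempty_of_ncard_ne_zero (expSumCount_pos hF hk hε (by omega)).ne'
    obtain ⟨t, ht⟩ := hne
    exact ⟨_, traceWord_mem hπ t, (hammingNorm_traceWord_eq_iff hF hπ (by omega) t ε i).2 ht⟩

end Weights

theorem theorem1 (m : ℕ) (hm : 6 ≤ m) (hm_even : Even m)
    (F : Type*) [Field F] [Fintype F] [Algebra (ZMod 3) F] (hF : Fintype.card F = 3 ^ m)
    (π : F) (hπ : IsPrimitiveRoot π (3 ^ m - 1))
    (C : Submodule (ZMod 3) (Fin (3 ^ m - 1) → ZMod 3))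
    (hC : C = cyclicCode (ZMod 3) (3 ^ m - 1)
      {π ^ (-2 : ℤ), π ^ (-(3 + 1) : ℤ), π ^ (-(3 ^ 2 + 1) : ℤ)}) :
    -- the nonzero weights are exactly these seven numbers
    (nonzeroWeights C = {codeWeight m 0 0,
        codeWeight m 1 0, codeWeight m (-1) 0,
        codeWeight m 1 2, codeWeight m (-1) 2,
        codeWeight m 1 4, codeWeight m (-1) 4} ∧
      (nonzeroWeights C).ncard = 7) ∧
    -- the frequencies, through the value distribution of the exponential sum
    ((∀ j ∈ ({1, 3} : Set ℕ), expSumCount F m 1 j = expSumCount F m (-1) j) ∧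
      weightFreq C (codeWeight m 0 0) = 2 * (expSumCount F m 1 1 + expSumCount F m 1 3) ∧
      (∀ ε ∈ ({1, -1} : Set ℤ), ∀ j ∈ ({0, 2, 4} : Set ℕ),
        weightFreq C (codeWeight m ε j) = expSumCount F m ε j)) ∧
    -- their explicit values
    (2 * (expSumCount F m 1 1 : ℚ) = Explicit.twoN1 3 m ∧
      2 * (expSumCount F m 1 3 : ℚ) = Explicit.twoN3 3 m ∧
      (∀ ε ∈ ({1, -1} : Set ℤ),
        (expSumCount F m ε 0 : ℚ) = Explicit.n0 3 m ε ∧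
        (expSumCount F m ε 2 : ℚ) = Explicit.n2 3 m ε ∧
        (expSumCount F m ε 4 : ℚ) = Explicit.n4 3 m ε)) := by
  have hC' : C = cyclicCode (ZMod 3) (3 ^ m - 1) (codeNonzeros π) := hC
  clear hC
  subst hC'
  obtain ⟨k, rfl⟩ := hm_even.two_dvd
  have hk : 3 ≤ k := by omega
  refine ⟨⟨nonzeroWeights_eq hF hπ hk, ?_⟩, ⟨?_, ?_, ?_⟩,
    two_mul_expSumCount_one hF (by omega), two_mul_expSumCount_three hF (by omega), ?_⟩
  · rw [nonzeroWeights_eq hF hπ hk, ncard_codeWeights (by omega)]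
  · rintro j (rfl | rfl)
    · exact expSumCount_neg_of_odd (by decide)
    · exact expSumCount_neg_of_odd (by decide)
  · rw [← ncard_union_expSumSet, ← setOf_re_charSum_eq_zero hF hk]
    exact weightFreq_eq_ncard hF hπ hk 0 0
  · intro ε hε j hj
    obtain ⟨i, hi, rfl⟩ : ∃ i ≤ 2, j = 2 * i := by
      rcases hj with rfl | rfl | rfl
      exacts [⟨0, by omega, rfl⟩, ⟨1, by omega, rfl⟩, ⟨2, by omega, rfl⟩]
    rw [weightFreq_eq_ncard hF hπ hk, setOf_re_charSum_eq hF hk hε hi, expSumCount]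
  · intro ε hε
    exact expSumCount_eq_explicit hF (by omega) hε
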